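/- Consider a Bayesian reinforcement-learning problem: standard Borel spaces $\mathcal S$ (states), $\mathcal A$ (actions) and $\Theta$ (MDPs), a prior $p(M)$ on $\Theta$, an initial-state kernel $\rho(S_1\mid M)$ and a kernel $p(S_{t+1},R_t\mid S_t,A_t,M)$ with real rewards satisfying $\sup_{s,a,M}\mathbb E[|R_t|\mid s,a,M]<\infty$. Its Bayes-adaptive MDP has augmented states $(S_t,b_t)$, where the belief $b_t$ is the posterior over MDPs: $b_1$ is the posterior of $M\sim p(M)$ given $S_1$, $(S_{t+1},R_t)\sim\mathbb E_{M\sim b_t}\,p(\cdot\mid S_t,A_t,M)$, and $b_{t+1}$ is the posterior of $M\sim b_t$ given $(S_t,A_t,S_{t+1},R_t)$. Fix a horizon $T$ and a $\sigma$-finite reference measure $\nu$ on $\mathcal A$. A policy $\pi^+$ consists of conditional laws $\pi^+_t(A_t\mid S_t,b_t)$ that are measurable in $(S_t,b_t)$ and have densities with respect to $\nu$. (If $\mathcal A$ is finite and $\nu$ is the counting measure, these are all policies.) Let $$\mathcal J(\pi)=\mathbb E_{p_\pi}\Big[\sum_{t=1}^T R_t\Big],\qquad \mathcal J_{\rm proxy}(q,\pi^+)=\mathbb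 E_{p_q}\Big[\sum_{t=1}^T R_t-\mathrm{KL}\big(q_t(\cdot\mid S_t,b_t)\,\|\,\pi_t^+(\cdot\mid S_t,b_t)\big)\Big]\in[-\infty,\infty),$$ and call a policy Bayes-optimal if it maximizes $\mathcal J$ over all policies. **Proposition.** Let $\pi^+_{(1)}$ be a policy with full support, i.e. its density is positive $\nu$-almost everywhere at every time $t\le T$ and every augmented state. For $i\ge1$ let $q^*_{(i+1)}$ be a maximizer of $\mathcal J_{\rm proxy}(\cdot,\pi^+_{(i)})$ (E-step) and $\pi^+_{(i+1)}$ a maximizer of $\mathcal J_{\rm proxy}(q^*_{(i+1)},\cdot)$ (M-step). Such a sequence exists, and every such sequence converges to Bayes-optimality in the following sense. 1. $\mathcal J(\pi^+_{(i)})\to\sup_\pi\mathcal J(\pi)$, and this supremum is finite. 2. If $\mathcal A$ is finite, there are Bayes-optimal policies $\pi^{*}_{(i)}$ such that, for every $t\le T$, every policy $p$, almost every $(s,b)$ under the law of $(S_t,b_t)$ induced by $p$, and every action $a$, $\pi^+_{(i),t}(a\mid s,b)-\pi^{*}_{(i),t}(a\mid s,b)\to0$ as $i\to\infty$. 3. If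 $\mathcal A$ is finite and, for some $\varepsilon>0$ and all $t\le T$, one has $\pi^+_{(1),t}(a\mid s,b)\ge\varepsilon$ for every $a$ and almost every $(s,b)$ under the law of $(S_t,b_t)$ induced by $\pi^+_{(1)}$, then there is a single Bayes-optimal policy $\pi^*$ such that, for every $t\le T$, every policy $p$, almost every $(s,b)$ under the law of $(S_t,b_t)$ induced by $p$, and every action $a$, $\pi^+_{(i),t}(a\mid s,b)\to\pi^*_t(a\mid s,b)$ as $i\to\infty$. -/

import Mathlib

open MeasureTheory ProbabilityTheory Filter Topology
open scoped ENNReal NNReal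

/-- A Bayesian reinforcement-learning problem with state space `S`, action space `A`, and a
measurable space `Θ` of Markov decision processes: a prior `p(M)` over MDPs, an initial-state kernel
`ρ(S₁ | M)`, and the joint kernel `p(S_{t+1}, R_t | M, S_t, A_t)`. -/
structure BayesRL (Θ S A : Type*) [MeasurableSpace Θ] [MeasurableSpace S] [MeasurableSpace A] where
  prior : Measure Θ
  init : Kernel Θ S
  dyn : Kernel (Θ × S × A) (S × ℝ)
  isProb_prior : IsProbabilityMeasure prior
  isMarkov_init : IsMarkovKernel init
  isMarkov_dyn : IsMarkovKernel dyn

/-- A belief is a probability measure over MDPs. -/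
abbrev Belief (Θ : Type*) [MeasurableSpace Θ] : Type _ := {b : Measure Θ // IsProbabilityMeasure b}

/-- A (possibly time-dependent) policy of the Bayes-adaptive MDP. `act t (s, b)` is the law
`π⁺(A_t | S_t = s, b_t = b)`; it has a density with respect to the reference measure `ν` on actions
(no restriction if actions are countable and `ν` is the counting measure). Decision epochs are
numbered `t = 0, …, T - 1`; what a policy does at `t ≥ T` never matters for horizon `T`. -/
structure BAPolicy {A : Type*} [MeasurableSpace A] (Θ S : Type*) [MeasurableSpace Θ]
    [MeasurableSpace S] (ν : Measure A) where
  act : ℕ → Kernel (S × Belief Θ) A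
  isMarkov : ∀ t, IsMarkovKernel (act t)
  hasDensity : ∀ t x, act t x ≪ ν

/-- Uniform bound on the first absolute moment of the rewards. -/
def BayesRL.RewardsBounded {Θ S A : Type*} [MeasurableSpace Θ] [MeasurableSpace S]
    [MeasurableSpace A] (P : BayesRL Θ S A) : Prop :=
  ∃ C : ℝ≥0, ∀ z, ∫⁻ o, ‖o.2‖ₑ ∂(P.dyn z) ≤ C

namespace BayesRL

noncomputable section

variable {Θ S A : Type*} [MeasurableSpace Θ] [MeasurableSpace S] [MeasurableSpace A]

attribute [instance] BayesRL.isProb_prior BayesRL.isMarkov_init BayesRL.isMarkov_dyn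
  BAPolicy.isMarkov

/-- The kernel that draws an MDP `M ~ b` from the belief part of `((s, b), a)`. -/
def sampleMDP : Kernel ((S × Belief Θ) × A) Θ where
  toFun z := z.1.2.1
  measurable' := measurable_subtype_coe.comp (measurable_snd.comp measurable_fst)

instance : IsMarkovKernel (sampleMDP : Kernel ((S × Belief Θ) × A) Θ) := ⟨fun z => z.1.2.2⟩

/-- The dynamics, reading its arguments from `(((s, b), a), M)`. -/
def dynAt (P : BayesRL Θ S A) : Kernel (((S × Belief Θ) × A) × Θ) (S × ℝ) :=
  P.dyn.comap (fun y => (y.2, y.1.1.1, y.1.2)) (by fun_prop)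

instance (P : BayesRL Θ S A) : IsMarkovKernel P.dynAt := by unfold dynAt; infer_instance

/-- Joint law of `((S_{t+1}, R_t), M)` given `((S_t, b_t), A_t)`, where `M ~ b_t` and
`(S_{t+1}, R_t) ~ p(· | M, S_t, A_t)`. -/
def joint (P : BayesRL Θ S A) : Kernel ((S × Belief Θ) × A) ((S × ℝ) × Θ) :=
  (sampleMDP ⊗ₖ P.dynAt).swapRight

instance (P : BayesRL Θ S A) : IsMarkovKernel P.joint := by unfold joint; infer_instance

/-- The predictive law `E_{M ~ b_t} p(S_{t+1}, R_t | M, S_t, A_t)` given `((S_t, b_t), A_t)`. -/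
def predictive (P : BayesRL Θ S A) : Kernel ((S × Belief Θ) × A) (S × ℝ) := P.joint.fst

instance (P : BayesRL Θ S A) : IsMarkovKernel P.predictive := by unfold predictive; infer_instance

variable [StandardBorelSpace Θ] [Nonempty Θ] [StandardBorelSpace S]

/-- Bayes' rule: the posterior of `M ~ b_t` given the transition `(S_t, A_t, S_{t+1}, R_t)`,
as a regular conditional distribution. -/
def nextBelief (P : BayesRL Θ S A) (z : ((S × Belief Θ) × A) × (S × ℝ)) : Belief Θ :=
  ⟨P.joint.condKernel z, inferInstance⟩

theorem measurable_nextBelief (P : BayesRL Θ S A) : Measurable P.nextBelief :=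
  P.joint.condKernel.measurable.subtype_mk

theorem measurable_initBelief (P : BayesRL Θ S A) : Measurable
    (fun s => (s, (⟨(P.init†P.prior) s, inferInstance⟩ : Belief Θ))) :=
  measurable_id.prodMk (P.init†P.prior).measurable.subtype_mk

/-- Law of `(S₁, b₁)`: `M ~ p(M)`, `S₁ ~ ρ(· | M)`, and `b₁` is the posterior of `M` given `S₁`
(which is `p(M)` itself when `S₁` does not depend on `M`). -/
def initLaw (P : BayesRL Θ S A) : Measure (S × Belief Θ) :=
  (P.prior.bind P.init).map (fun s => (s, (⟨(P.init†P.prior) s, inferInstance⟩ : Belief Θ)))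

variable {ν : Measure A}

/-- Joint law of `(((S_t, b_t), A_t), (S_{t+1}, R_t))` if `(S_t, b_t) ~ m` and
`A_t ~ κ(· | S_t, b_t)`. -/
def stepLaw (P : BayesRL Θ S A) (κ : Kernel (S × Belief Θ) A) (m : Measure (S × Belief Θ)) :
    Measure (((S × Belief Θ) × A) × (S × ℝ)) :=
  (m ⊗ₘ κ) ⊗ₘ P.predictive

/-- Law of the augmented state `(S_t, b_t)` at epoch `t` under the policy `π`. -/
def stateLaw (P : BayesRL Θ S A) (π : BAPolicy Θ S ν) : ℕ → Measure (S × Belief Θ)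
  | 0 => P.initLaw
  | t + 1 => (P.stepLaw (π.act t) (P.stateLaw π t)).map (fun z => (z.2.1, P.nextBelief z))

instance (P : BayesRL Θ S A) : IsProbabilityMeasure P.initLaw :=
  Measure.isProbabilityMeasure_map P.measurable_initBelief.aemeasurable

instance isProbabilityMeasure_stateLaw (P : BayesRL Θ S A) (π : BAPolicy Θ S ν) :
    ∀ t, IsProbabilityMeasure (P.stateLaw π t)
  | 0 => by unfold stateLaw; infer_instance
  | t + 1 => by
    have := isProbabilityMeasure_stateLaw P π t
    unfold stateLaw stepLaw
    exact Measure.isProbabilityMeasure_map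
      ((measurable_fst.comp measurable_snd).prodMk P.measurable_nextBelief).aemeasurable

/-- Expected return `E_{p_π} [∑_t R_t]` over the horizon `T`. -/
def expReturn (P : BayesRL Θ S A) (T : ℕ) (π : BAPolicy Θ S ν) : ℝ :=
  ∑ t ∈ Finset.range T, ∫ z, z.2.2 ∂(P.stepLaw (π.act t) (P.stateLaw π t))

/-- Expected cumulative divergence `E_{p_q} [∑_t KL(q(· | S_t, b_t) ‖ π(· | S_t, b_t))]`. -/
def klCost (P : BayesRL Θ S A) (T : ℕ) (q π : BAPolicy Θ S ν) : ℝ≥0∞ :=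
  ∑ t ∈ Finset.range T, ∫⁻ x, InformationTheory.klDiv (q.act t x) (π.act t x) ∂(P.stateLaw q t)

/-- The proxy objective `J_proxy(q, π) = E_{p_q} [∑_t R_t - KL(q ‖ π)]`, equal to `-∞` if the
expected divergence is infinite. -/
def proxy (P : BayesRL Θ S A) (T : ℕ) (q π : BAPolicy Θ S ν) : EReal :=
  (P.expReturn T q : EReal) - (P.klCost T q π : EReal)

/-- A Bayes-optimal policy: an optimal policy of the Bayes-adaptive MDP. -/
def IsBayesOptimal (P : BayesRL Θ S A) (T : ℕ) (π : BAPolicy Θ S ν) : Prop :=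
  ∀ p : BAPolicy Θ S ν, P.expReturn T p ≤ P.expReturn T π

/-- `(π i)` and `(q i)` are produced by exact expectation-maximization from the prior policy `π 0`.
The E-step makes `q (i + 1)` a maximizer of `J_proxy(·, π i)`, the M-step makes `π (i + 1)` a
maximizer of `J_proxy(q (i + 1), ·)`. The value `q 0` is irrelevant. -/
def IsEMRun (P : BayesRL Θ S A) (T : ℕ) (π q : ℕ → BAPolicy Θ S ν) : Prop :=
  ∀ i, (∀ p, P.proxy T p (π i) ≤ P.proxy T (q (i + 1)) (π i)) ∧
    (∀ p, P.proxy T (q (i + 1)) p ≤ P.proxy T (q (i + 1)) (π (i + 1)))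

end

end BayesRL

/-! ### Exponential tilting and relative entropy. -/

section Auxiliary

open InformationTheory

/-! Relative to a prior policy `π`, the proxy objective is a KL-regularized control problem solved
by soft dynamic programming. Its optimum `improve` tilts each action law by the soft `Q`-value, and
the Gibbs identity together with the performance-difference identity writes the objective as the
soft value minus the divergence from `improve` (`proxy_eq_sub`). So the E-step is forced almost
everywhere and the M-step copies it. A full-support policy has state laws dominating those of every
policy, so every run agrees with the canonical run `softIterate` on almost all reachable states
(`IsEMRun.ae_act_eq_softIterate`).

Along the canonical run the soft values `V_i` increase pointwise and are uniformly bounded, with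
limits `V*` and `Q*`. The `i`-th iterate has density `exp (∑_{j<i} (Q_j - V_j))` relative to `π₁`
(`softIterate_act`). Since its mass is one, Fatou's lemma forces `Q* ≤ V*` almost surely in the
action; performance difference then bounds every return by `∫ V*`, while the returns of the iterates
dominate the soft values, which tend to `∫ V*`. This gives convergence of returns.

For finite `A`, actions with `Q* < V*` lose all their mass, so the iterates approach their own
conditionings on `Q* = V*`, which are optimal. On optimal actions the log density is a difference of
two increasing sequences, the accumulated gaps of `V` and of `Q`. A lower bound on `π₁` bounds both
by backward induction (`exists_ae_valueGap_le`), hence the iterates themselves converge. -/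

theorem MeasureTheory.integrable_of_forall_abs_le {α : Type*} [MeasurableSpace α] {μ : Measure α}
    [IsFiniteMeasure μ] {f : α → ℝ} {B : ℝ} (hf : Measurable f) (hB : ∀ x, |f x| ≤ B) :
    Integrable f μ :=
  Integrable.of_bound hf.aestronglyMeasurable B (ae_of_all _ hB)

theorem MeasureTheory.integrable_exp_of_forall_abs_le {α : Type*} [MeasurableSpace α]
    {μ : Measure α} [IsFiniteMeasure μ] {f : α → ℝ} {B : ℝ} (hf : Measurable f)
    (hB : ∀ x, |f x| ≤ B) : Integrable (fun x => Real.exp (f x)) μ :=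
  integrable_of_forall_abs_le (B := Real.exp B) hf.exp fun x => by
    rw [abs_of_pos (Real.exp_pos _)]
    exact Real.exp_le_exp.2 (abs_le.1 (hB x)).2

theorem MeasureTheory.abs_integral_le_of_forall_abs_le {α : Type*} [MeasurableSpace α]
    {μ : Measure α} [IsProbabilityMeasure μ] {f : α → ℝ} {B : ℝ} (hB : ∀ x, |f x| ≤ B) :
    |∫ x, f x ∂μ| ≤ B := by
  simpa using norm_integral_le_of_norm_le_const (μ := μ) (f := f) (C := B) (ae_of_all _ hB)

theorem MeasureTheory.abs_log_integral_exp_le {α : Type*} [MeasurableSpace α] {μ : Measure α}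
    [IsProbabilityMeasure μ] {f : α → ℝ} {B : ℝ} (hf : Measurable f) (hB : ∀ x, |f x| ≤ B) :
    |Real.log (∫ x, Real.exp (f x) ∂μ)| ≤ B := by
  have hi := integrable_exp_of_forall_abs_le (μ := μ) hf hB
  have hpos : 0 < ∫ x, Real.exp (f x) ∂μ := integral_exp_pos hi
  rw [abs_le]
  constructor
  · rw [Real.le_log_iff_exp_le hpos]
    simpa using integral_mono (integrable_const (Real.exp (-B))) hi
      fun x => Real.exp_le_exp.2 (abs_le.1 (hB x)).1
  · rw [Real.log_le_iff_le_exp hpos]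
    simpa using integral_mono hi (integrable_const (Real.exp B))
      fun x => Real.exp_le_exp.2 (abs_le.1 (hB x)).2

/-- A bounded tilt preserves null sets and changes the log-likelihood ratio by a bounded function.
-/
theorem InformationTheory.klDiv_tilted_right_eq_top_iff {α : Type*} [MeasurableSpace α]
    {p μ : Measure α} [IsProbabilityMeasure p] [IsProbabilityMeasure μ] {f : α → ℝ} {B : ℝ}
    (hf : Measurable f) (hB : ∀ x, |f x| ≤ B) :
    klDiv p (μ.tilted f) = ∞ ↔ klDiv p μ = ∞ := by
  have hi := integrable_exp_of_forall_abs_le (μ := μ) hf hB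
  have hac : p ≪ μ.tilted f ↔ p ≪ μ :=
    ⟨fun h => h.trans (tilted_absolutelyContinuous _ _),
      fun h => h.trans (absolutelyContinuous_tilted hi)⟩
  rw [klDiv_eq_top_iff, klDiv_eq_top_iff, hac]
  refine imp_congr_right fun h => not_congr ?_
  rw [integrable_congr (llr_tilted_right h hi)]
  have hg : Integrable (fun x => -f x + Real.log (∫ z, Real.exp (f z) ∂μ)) p :=
    (integrable_of_forall_abs_le hf hB).neg.add (integrable_const _)
  exact ⟨fun h' => (h'.sub hg).congr (ae_of_all _ fun x => by simp), fun h' => hg.add h'⟩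

/-- The Gibbs variational identity. -/
theorem InformationTheory.klDiv_add_ofReal_eq_klDiv_tilted_add {α : Type*} [MeasurableSpace α]
    {p μ : Measure α} [IsProbabilityMeasure p] [IsProbabilityMeasure μ] {f : α → ℝ} {B : ℝ}
    (hf : Measurable f) (hB : ∀ x, |f x| ≤ B) :
    klDiv p μ + ENNReal.ofReal (B - ∫ x, f x ∂p) =
      klDiv p (μ.tilted f) + ENNReal.ofReal (B - Real.log (∫ x, Real.exp (f x) ∂μ)) := by
  -- Shifting by `B` makes all four terms nonnegative, so the identity lives in `ℝ≥0∞`, covers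
  -- infinite divergence, and can be integrated over states without integrability conditions.
  by_cases htop : klDiv p μ = ∞
  · rw [htop, (klDiv_tilted_right_eq_top_iff hf hB).2 htop, top_add, top_add]
  have htop' : klDiv p (μ.tilted f) ≠ ∞ := by rwa [Ne, klDiv_tilted_right_eq_top_iff hf hB]
  have hi := integrable_exp_of_forall_abs_le (μ := μ) hf hB
  have : IsProbabilityMeasure (μ.tilted f) := isProbabilityMeasure_tilted hi
  obtain ⟨hac, hint⟩ := klDiv_ne_top_iff.1 htop
  have h1 : 0 ≤ B - ∫ x, f x ∂p :=
    sub_nonneg.2 (abs_le.1 (abs_integral_le_of_forall_abs_le hB)).2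
  have h2 : 0 ≤ B - Real.log (∫ x, Real.exp (f x) ∂μ) :=
    sub_nonneg.2 (abs_le.1 (abs_log_integral_exp_le hf hB)).2
  rw [← ENNReal.ofReal_toReal htop, ← ENNReal.ofReal_toReal htop',
    ← ENNReal.ofReal_add ENNReal.toReal_nonneg h1, ← ENNReal.ofReal_add ENNReal.toReal_nonneg h2,
    toReal_klDiv_of_measure_eq hac (by simp),
    toReal_klDiv_of_measure_eq (hac.trans (absolutelyContinuous_tilted hi)) (by simp),
    integral_llr_tilted_right hac (integrable_of_forall_abs_le hf hB) hi hint]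
  congr 1
  ring

/-- Rests on the jointly measurable kernel version of the Radon–Nikodym derivative. It is what lets
a vanishing expected divergence yield almost-everywhere equality of action laws. -/
theorem ProbabilityTheory.Kernel.measurable_klDiv {X A : Type*} [MeasurableSpace X]
    [MeasurableSpace A] [MeasurableSpace.CountableOrCountablyGenerated X A]
    (κ η : Kernel X A) [IsFiniteKernel κ] [IsFiniteKernel η] :
    Measurable fun x => klDiv (κ x) (η x) := by
  classical
  have h : (fun x => klDiv (κ x) (η x)) = fun x => if κ x ≪ η x then
      ∫⁻ a, ENNReal.ofReal (klFun (κ.rnDeriv η x a).toReal) ∂(η x) else ∞ := by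
    ext x
    split_ifs with hx
    · rw [klDiv_eq_lintegral_klFun_of_ac hx]
      refine lintegral_congr_ae ?_
      filter_upwards [κ.rnDeriv_eq_rnDeriv_measure (η := η) (a := x)] with a ha
      rw [ha]
    · exact klDiv_of_not_ac hx
  rw [h]
  refine Measurable.ite (Kernel.measurableSet_absolutelyContinuous κ η) ?_ measurable_const
  exact Measurable.lintegral_kernel_prod_right
    (f := fun x a => ENNReal.ofReal (klFun (κ.rnDeriv η x a).toReal))
    (measurable_klFun.comp (Kernel.measurable_rnDeriv κ η).ennreal_toReal).ennreal_ofReal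

end Auxiliary

/-! ### Policies given by densities relative to a policy. -/

namespace BAPolicy

variable {Θ S A : Type*} [MeasurableSpace Θ] [MeasurableSpace S] [MeasurableSpace A]
  {ν : Measure A}

/-- The policy with density `f` relative to `π`. -/
noncomputable def reweight (π : BAPolicy Θ S ν) (f : ℕ → (S × Belief Θ) × A → ℝ≥0∞)
    (hf : ∀ t, Measurable (f t)) (h1 : ∀ t x, ∫⁻ a, f t (x, a) ∂(π.act t x) = 1) :
    BAPolicy Θ S ν where
  act t := (π.act t).withDensity (fun x a => f t (x, a))
  isMarkov t := ⟨fun x => ⟨by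
    rw [Kernel.withDensity_apply (f := fun x a => f t (x, a)) _ (hf t),
      withDensity_apply _ MeasurableSet.univ, Measure.restrict_univ, h1]⟩⟩
  hasDensity t x := (Kernel.withDensity_absolutelyContinuous (κ := π.act t)
    (fun x a => f t (x, a)) x).trans (π.hasDensity t x)

theorem reweight_act (π : BAPolicy Θ S ν) (f : ℕ → (S × Belief Θ) × A → ℝ≥0∞)
    (hf : ∀ t, Measurable (f t)) (h1 : ∀ t x, ∫⁻ a, f t (x, a) ∂(π.act t x) = 1) (t : ℕ)
    (x : S × Belief Θ) :
    (π.reweight f hf h1).act t x = (π.act t x).withDensity (fun a => f t (x, a)) :=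
  Kernel.withDensity_apply (f := fun x a => f t (x, a)) _ (hf t) x

/-- The policy whose action law at epoch `t` is the exponential tilting of `π` by `f t`. -/
noncomputable def tilt (π : BAPolicy Θ S ν) (f : ℕ → (S × Belief Θ) × A → ℝ)
    (hf : ∀ t, Measurable (f t)) (hB : ∀ t, ∃ B, ∀ z, |f t z| ≤ B) : BAPolicy Θ S ν :=
  π.reweight (fun t z => ENNReal.ofReal
      (Real.exp (f t z) / ∫ a, Real.exp (f t (z.1, a)) ∂(π.act t z.1)))
    (fun t => ((hf t).exp.div ((StronglyMeasurable.integral_kernel_prod_right'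
      (κ := π.act t) (hf t).exp.stronglyMeasurable).measurable.comp
        measurable_fst)).ennreal_ofReal)
    (fun t x => by
      obtain ⟨B, hB⟩ := hB t
      have hm : Measurable fun a => f t (x, a) := (hf t).comp measurable_prodMk_left
      have := isProbabilityMeasure_tilted
        (integrable_exp_of_forall_abs_le (μ := π.act t x) hm fun a => hB (x, a))
      rw [← this.measure_univ, Measure.tilted, withDensity_apply _ MeasurableSet.univ,
        Measure.restrict_univ])

theorem tilt_act (π : BAPolicy Θ S ν) (f : ℕ → (S × Belief Θ) × A → ℝ)
    (hf : ∀ t, Measurable (f t)) (hB : ∀ t, ∃ B, ∀ z, |f t z| ≤ B) (t : ℕ)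
    (x : S × Belief Θ) :
    (π.tilt f hf hB).act t x = (π.act t x).tilted fun a => f t (x, a) :=
  π.reweight_act _ _ _ t x

end BAPolicy

/-! ### The Bayes-adaptive dynamics and performance differences. -/

namespace BayesRL

section Dynamics

variable {Θ S A : Type*} [MeasurableSpace Θ] [MeasurableSpace S] [MeasurableSpace A]

/-- Expected immediate reward in an augmented state. -/
noncomputable def meanReward (P : BayesRL Θ S A) (z : (S × Belief Θ) × A) : ℝ :=
  ∫ o, o.2 ∂(P.predictive z)

theorem measurable_meanReward (P : BayesRL Θ S A) : Measurable P.meanReward :=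
  (StronglyMeasurable.integral_kernel (κ := P.predictive)
    measurable_snd.stronglyMeasurable).measurable

theorem lintegral_predictive_le (P : BayesRL Θ S A) {C : ℝ≥0}
    (hC : ∀ z, ∫⁻ o, ‖o.2‖ₑ ∂(P.dyn z) ≤ C) (z : (S × Belief Θ) × A) :
    ∫⁻ o, ‖o.2‖ₑ ∂(P.predictive z) ≤ C := by
  have hm : Measurable fun o : S × ℝ => ‖o.2‖ₑ := measurable_snd.enorm
  rw [predictive, joint, Kernel.fst_swapRight, Kernel.lintegral_snd _ _ hm,
    Kernel.lintegral_compProd (f := fun b : Θ × S × ℝ => ‖b.2.2‖ₑ) _ _ _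
      (hm.comp measurable_snd)]
  calc ∫⁻ M, ∫⁻ o, ‖o.2‖ₑ ∂(P.dynAt (z, M)) ∂(sampleMDP z)
      ≤ ∫⁻ _, C ∂(sampleMDP z) := lintegral_mono fun M => hC _
    _ = C := by simp

theorem RewardsBounded.exists_abs_meanReward_le {P : BayesRL Θ S A} (hR : P.RewardsBounded) :
    ∃ C : ℝ, 0 ≤ C ∧ ∀ z, |P.meanReward z| ≤ C := by
  obtain ⟨C, hC⟩ := hR
  refine ⟨C, C.2, fun z => ?_⟩
  have h := (enorm_integral_le_lintegral_enorm (μ := P.predictive z) (fun o : S × ℝ => o.2)).trans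
    (P.lintegral_predictive_le hC z)
  rw [← ofReal_norm, ← ENNReal.ofReal_coe_nnreal] at h
  exact (ENNReal.ofReal_le_ofReal_iff C.2).1 h

variable [StandardBorelSpace Θ] [Nonempty Θ] [StandardBorelSpace S] {ν : Measure A}

/-- The transition kernel of the Bayes-adaptive MDP. -/
noncomputable def transition (P : BayesRL Θ S A) :
    Kernel ((S × Belief Θ) × A) (S × Belief Θ) :=
  (Kernel.id ×ₖ P.predictive).map (fun z => (z.2.1, P.nextBelief z))

theorem measurable_nextState (P : BayesRL Θ S A) :
    Measurable fun z : ((S × Belief Θ) × A) × (S × ℝ) => (z.2.1, P.nextBelief z) :=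
  (measurable_fst.comp measurable_snd).prodMk P.measurable_nextBelief

instance (P : BayesRL Θ S A) : IsMarkovKernel P.transition :=
  Kernel.IsMarkovKernel.map _ P.measurable_nextState

theorem stateLaw_succ (P : BayesRL Θ S A) (π : BAPolicy Θ S ν) (t : ℕ) :
    P.stateLaw π (t + 1) = P.transition ∘ₘ (P.stateLaw π t ⊗ₘ π.act t) := by
  rw [stateLaw, stepLaw, transition, Measure.compProd_eq_comp_prod _ P.predictive,
    Measure.map_comp _ _ P.measurable_nextState]

/-- The state-action value obtained from the continuation value `V`. -/
noncomputable def lookahead (P : BayesRL Θ S A) (V : S × Belief Θ → ℝ) (z : (S × Belief Θ) × A) :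
    ℝ :=
  P.meanReward z + ∫ y, V y ∂(P.transition z)

theorem measurable_lookahead (P : BayesRL Θ S A) {V : S × Belief Θ → ℝ} (hV : Measurable V) :
    Measurable (P.lookahead V) :=
  P.measurable_meanReward.add
    (StronglyMeasurable.integral_kernel (κ := P.transition) hV.stronglyMeasurable).measurable

theorem abs_lookahead_le {P : BayesRL Θ S A} {C B : ℝ} (hC : ∀ z, |P.meanReward z| ≤ C)
    {V : S × Belief Θ → ℝ} (hB : ∀ x, |V x| ≤ B) (z : (S × Belief Θ) × A) :
    |P.lookahead V z| ≤ C + B :=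
  (abs_add_le _ _).trans (add_le_add (hC z) (abs_integral_le_of_forall_abs_le hB))

theorem lookahead_mono (P : BayesRL Θ S A) {V W : S × Belief Θ → ℝ} {B : ℝ} (hV : Measurable V)
    (hW : Measurable W) (hVB : ∀ x, |V x| ≤ B) (hWB : ∀ x, |W x| ≤ B) (h : ∀ x, V x ≤ W x)
    (z : (S × Belief Θ) × A) : P.lookahead V z ≤ P.lookahead W z :=
  add_le_add_right (integral_mono (integrable_of_forall_abs_le hV hVB)
    (integrable_of_forall_abs_le hW hWB) h) _

theorem integral_stateLaw_succ (P : BayesRL Θ S A) (π : BAPolicy Θ S ν) (t : ℕ)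
    {V : S × Belief Θ → ℝ} {B : ℝ} (hV : Measurable V) (hVB : ∀ x, |V x| ≤ B) :
    ∫ x, V x ∂(P.stateLaw π (t + 1)) =
      ∫ z, ∫ y, V y ∂(P.transition z) ∂(P.stateLaw π t ⊗ₘ π.act t) := by
  rw [P.stateLaw_succ π t, ← Measure.snd_compProd, Measure.snd,
    integral_map measurable_snd.aemeasurable hV.aestronglyMeasurable, Measure.integral_compProd]
  exact integrable_of_forall_abs_le (hV.comp measurable_snd) fun z => hVB z.2

theorem integral_stepLaw_reward {P : BayesRL Θ S A} (hR : P.RewardsBounded)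
    (π : BAPolicy Θ S ν) (t : ℕ) :
    ∫ z, z.2.2 ∂(P.stepLaw (π.act t) (P.stateLaw π t)) =
      ∫ z, P.meanReward z ∂(P.stateLaw π t ⊗ₘ π.act t) := by
  obtain ⟨C, hC⟩ := hR
  have hm : Measurable fun z : ((S × Belief Θ) × A) × (S × ℝ) => z.2.2 :=
    measurable_snd.comp measurable_snd
  rw [stepLaw, Measure.integral_compProd]
  · rfl
  · refine ⟨hm.aestronglyMeasurable, ?_⟩
    rw [hasFiniteIntegral_iff_enorm, Measure.lintegral_compProd hm.enorm]
    calc ∫⁻ z, ∫⁻ o, ‖o.2‖ₑ ∂(P.predictive z) ∂(P.stateLaw π t ⊗ₘ π.act t)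
        ≤ ∫⁻ _, C ∂(P.stateLaw π t ⊗ₘ π.act t) :=
          lintegral_mono fun z => P.lintegral_predictive_le hC z
      _ < ∞ := by simp

theorem integral_lookahead {P : BayesRL Θ S A} (hR : P.RewardsBounded)
    (π : BAPolicy Θ S ν) (t : ℕ) {V : S × Belief Θ → ℝ} {B : ℝ} (hV : Measurable V)
    (hVB : ∀ x, |V x| ≤ B) :
    ∫ x, ∫ a, P.lookahead V (x, a) ∂(π.act t x) ∂(P.stateLaw π t) =
      ∫ z, z.2.2 ∂(P.stepLaw (π.act t) (P.stateLaw π t)) +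
        ∫ x, V x ∂(P.stateLaw π (t + 1)) := by
  obtain ⟨C, -, hC⟩ := hR.exists_abs_meanReward_le
  rw [integral_stepLaw_reward hR, P.integral_stateLaw_succ π t hV hVB, ← integral_add,
    ← Measure.integral_compProd]
  · rfl
  · exact integrable_of_forall_abs_le (P.measurable_lookahead hV) (abs_lookahead_le hC hVB)
  · exact integrable_of_forall_abs_le P.measurable_meanReward hC
  · exact integrable_of_forall_abs_le
      (StronglyMeasurable.integral_kernel (κ := P.transition) hV.stronglyMeasurable).measurable
      fun z => abs_integral_le_of_forall_abs_le hVB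

/-- Performance-difference identity. -/
theorem expReturn_eq_add_sum {P : BayesRL Θ S A} (hR : P.RewardsBounded) (T : ℕ)
    (p : BAPolicy Θ S ν) {V : ℕ → S × Belief Θ → ℝ} {B : ℝ} (hV : ∀ t, Measurable (V t))
    (hVB : ∀ t x, |V t x| ≤ B) (hVT : ∀ x, V T x = 0) :
    P.expReturn T p = ∫ x, V 0 x ∂P.initLaw +
      ∑ t ∈ Finset.range T, (∫ x, ∫ a, P.lookahead (V (t + 1)) (x, a) ∂(p.act t x)
        ∂(P.stateLaw p t) - ∫ x, V t x ∂(P.stateLaw p t)) := by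
  simp_rw [fun t => integral_lookahead hR p t (hV (t + 1)) (hVB (t + 1)), add_sub_assoc,
    Finset.sum_add_distrib]
  -- The value terms telescope; the one at `T` vanishes by `hVT`.
  rw [Finset.sum_range_sub fun t => ∫ x, V t x ∂(P.stateLaw p t)]
  simp [hVT, expReturn, stateLaw]

/-- Action laws satisfy `p ≪ ν ≪ π` and the transition kernel is shared, so domination propagates in
time. Exceptional sets under a full-support policy are thus null for all policies. -/
theorem absolutelyContinuous_stateLaw (P : BayesRL Θ S A) {T : ℕ} {π : BAPolicy Θ S ν}
    (hfull : ∀ t < T, ∀ x, ν ≪ π.act t x) (p : BAPolicy Θ S ν) {t : ℕ} (ht : t ≤ T) :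
    P.stateLaw p t ≪ P.stateLaw π t := by
  induction t with
  | zero => exact Measure.AbsolutelyContinuous.rfl
  | succ t ih =>
    rw [stateLaw_succ, stateLaw_succ]
    exact ((ih (by lia)).compProd (ae_of_all _ fun x =>
      (p.hasDensity t x).trans (hfull t ht x))).comp_right _

theorem ae_stateLaw_succ (P : BayesRL Θ S A) (π : BAPolicy Θ S ν) {t : ℕ}
    {r : S × Belief Θ → Prop} (h : ∀ᵐ x ∂(P.stateLaw π (t + 1)), r x) :
    ∀ᵐ x ∂(P.stateLaw π t), ∀ᵐ a ∂(π.act t x), ∀ᵐ y ∂(P.transition (x, a)), r y := by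
  rw [stateLaw_succ] at h
  exact Measure.ae_ae_of_ae_compProd (Measure.ae_ae_of_ae_comp h)

theorem stateLaw_congr (P : BayesRL Θ S A) {T : ℕ} {p q : BAPolicy Θ S ν}
    (h : ∀ t < T, ∀ᵐ x ∂(P.stateLaw p t), p.act t x = q.act t x) {t : ℕ} (ht : t ≤ T) :
    P.stateLaw p t = P.stateLaw q t := by
  induction t with
  | zero => rfl
  | succ t ih =>
    rw [stateLaw_succ, stateLaw_succ, ← ih (by lia), Measure.compProd_congr (h t ht)]

theorem expReturn_congr (P : BayesRL Θ S A) {T : ℕ} {p q : BAPolicy Θ S ν}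
    (h : ∀ t < T, ∀ᵐ x ∂(P.stateLaw p t), p.act t x = q.act t x) :
    P.expReturn T p = P.expReturn T q := by
  refine Finset.sum_congr rfl fun t ht => ?_
  rw [Finset.mem_range] at ht
  rw [stepLaw, stepLaw, ← P.stateLaw_congr h ht.le, Measure.compProd_congr (h t ht)]

end Dynamics

end BayesRL

/-- Turns maximality in either EM step into zero divergence. -/
theorem EReal.eq_zero_of_coe_le_coe_sub {a : ℝ} {k : ℝ≥0∞} (h : (a : EReal) ≤ (a : EReal) - k) :
    k = 0 := by
  by_cases hk : k = ∞
  · simp [hk] at h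
  lift k to ℝ≥0 using hk
  have h' : (a : EReal) ≤ ((a - k : ℝ) : EReal) := h
  rw [EReal.coe_le_coe_iff] at h'
  have : (k : ℝ) ≤ 0 := by linarith
  simpa using le_antisymm this k.2

/-! ### Soft values and the exact form of an EM step. -/

namespace BayesRL

section SoftValue

open InformationTheory

variable {Θ S A : Type*} [MeasurableSpace Θ] [MeasurableSpace S] [MeasurableSpace A]
  [StandardBorelSpace Θ] [Nonempty Θ] [StandardBorelSpace S] {ν : Measure A}

/-- Soft-optimal value of the KL-regularized problem with prior policy `π` and `n` decision epochs
to go before the horizon `T`. -/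
noncomputable def softValueToGo (P : BayesRL Θ S A) (T : ℕ) (π : BAPolicy Θ S ν) :
    ℕ → S × Belief Θ → ℝ
  | 0 => 0
  | n + 1 => fun x => Real.log
      -- With `n + 1` decisions left the epoch is `T - (n + 1)`; `softValue` never asks for more
      -- than `T` decisions, so truncation plays no role there.
      (∫ a, Real.exp (P.lookahead (softValueToGo P T π n) (x, a)) ∂(π.act (T - (n + 1)) x))

/-- Soft-optimal value at epoch `t`. -/
noncomputable def softValue (P : BayesRL Θ S A) (T : ℕ) (π : BAPolicy Θ S ν) (t : ℕ) :
    S × Belief Θ → ℝ :=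
  P.softValueToGo T π (T - t)

/-- Soft-optimal state-action value at epoch `t`. -/
noncomputable def softQ (P : BayesRL Θ S A) (T : ℕ) (π : BAPolicy Θ S ν) (t : ℕ) :
    (S × Belief Θ) × A → ℝ :=
  P.lookahead (P.softValue T π (t + 1))

theorem softValue_horizon (P : BayesRL Θ S A) (T : ℕ) (π : BAPolicy Θ S ν) (x : S × Belief Θ) :
    P.softValue T π T x = 0 := by
  simp [softValue, softValueToGo]

theorem softValue_of_lt (P : BayesRL Θ S A) {T : ℕ} (π : BAPolicy Θ S ν) {t : ℕ} (ht : t < T)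
    (x : S × Belief Θ) : P.softValue T π t x =
      Real.log (∫ a, Real.exp (P.softQ T π t (x, a)) ∂(π.act t x)) := by
  obtain ⟨n, rfl⟩ : ∃ n, T = t + (n + 1) := ⟨T - t - 1, by lia⟩
  have h1 : t + (n + 1) - t = n + 1 := by lia
  have h2 : t + (n + 1) - (t + 1) = n := by lia
  have h3 : t + (n + 1) - (n + 1) = t := by lia
  simp [softQ, softValue, softValueToGo, h1, h2, h3]

theorem measurable_softValueToGo (P : BayesRL Θ S A) (T : ℕ) (π : BAPolicy Θ S ν) (n : ℕ) :
    Measurable (P.softValueToGo T π n) := by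
  induction n with
  | zero => exact measurable_const
  | succ n ih =>
    exact (StronglyMeasurable.integral_kernel_prod_right' (κ := π.act (T - (n + 1)))
      (P.measurable_lookahead ih).exp.stronglyMeasurable).measurable.log

theorem measurable_softValue (P : BayesRL Θ S A) (T : ℕ) (π : BAPolicy Θ S ν) (t : ℕ) :
    Measurable (P.softValue T π t) :=
  P.measurable_softValueToGo T π _

theorem measurable_softQ (P : BayesRL Θ S A) (T : ℕ) (π : BAPolicy Θ S ν) (t : ℕ) :
    Measurable (P.softQ T π t) :=
  P.measurable_lookahead (P.measurable_softValue T π _)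

/-- A log-mean-exp obeys the bound of its integrand, so each epoch costs only `C`, whatever the
prior policy. This uniformity supplies the dominating constant along the run. -/
theorem abs_softValueToGo_le {P : BayesRL Θ S A} {C : ℝ} (hC : ∀ z, |P.meanReward z| ≤ C) (T : ℕ)
    (π : BAPolicy Θ S ν) (n : ℕ) (x : S × Belief Θ) : |P.softValueToGo T π n x| ≤ n * C := by
  induction n generalizing x with
  | zero => simp [softValueToGo]
  | succ n ih =>
    have := abs_log_integral_exp_le (μ := π.act (T - (n + 1)) x)
      ((P.measurable_lookahead (P.measurable_softValueToGo T π n)).comp measurable_prodMk_left)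
      fun a => abs_lookahead_le hC ih (x, a)
    exact this.trans_eq (by push_cast; ring)

/-- The soft values and state-action values are bounded uniformly over all prior policies. -/
theorem RewardsBounded.exists_bound {P : BayesRL Θ S A} (hR : P.RewardsBounded) (T : ℕ)
    (ν : Measure A) : ∃ B : ℝ, 0 ≤ B ∧ ∀ (π : BAPolicy Θ S ν) (t : ℕ),
      (∀ x, |P.softValue T π t x| ≤ B) ∧ ∀ z, |P.softQ T π t z| ≤ B := by
  obtain ⟨C, hC0, hC⟩ := hR.exists_abs_meanReward_le
  have h : ∀ (π : BAPolicy Θ S ν) (t : ℕ) (x), |P.softValue T π t x| ≤ T * C := fun π t x =>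
    (abs_softValueToGo_le hC T π _ x).trans (by gcongr; lia)
  exact ⟨C + T * C, by positivity, fun π t => ⟨fun x => (h π t x).trans (by linarith),
    abs_lookahead_le hC (h π _)⟩⟩

/-- The soft-optimal policy relative to the prior policy `π`: one exact EM step. -/
noncomputable def improve {P : BayesRL Θ S A} (hR : P.RewardsBounded) (T : ℕ)
    (π : BAPolicy Θ S ν) : BAPolicy Θ S ν :=
  π.tilt (P.softQ T π) (P.measurable_softQ T π)
    fun t => (hR.exists_bound T ν).imp fun _ h => (h.2 π t).2

theorem improve_act {P : BayesRL Θ S A} (hR : P.RewardsBounded) (T : ℕ) (π : BAPolicy Θ S ν)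
    (t : ℕ) (x : S × Belief Θ) :
    (improve hR T π).act t x = (π.act t x).tilted fun a => P.softQ T π t (x, a) :=
  π.tilt_act _ _ _ t x

/-- The Gibbs identity at each state, integrated over the state law; the normalizing constant of the
tilt is the exponential of the soft value. -/
theorem lintegral_klDiv_add {P : BayesRL Θ S A} (hR : P.RewardsBounded) {T : ℕ}
    (p π : BAPolicy Θ S ν) {B : ℝ} (hVB : ∀ t x, |P.softValue T π t x| ≤ B)
    (hQB : ∀ t z, |P.softQ T π t z| ≤ B) {t : ℕ} (ht : t < T) :
    ∫⁻ x, klDiv (p.act t x) (π.act t x) ∂(P.stateLaw p t) +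
        ENNReal.ofReal (B - ∫ x, ∫ a, P.softQ T π t (x, a) ∂(p.act t x) ∂(P.stateLaw p t)) =
      ∫⁻ x, klDiv (p.act t x) ((improve hR T π).act t x) ∂(P.stateLaw p t) +
        ENNReal.ofReal (B - ∫ x, P.softValue T π t x ∂(P.stateLaw p t)) := by
  have hQm : Measurable fun x => ∫ a, P.softQ T π t (x, a) ∂(p.act t x) :=
    (StronglyMeasurable.integral_kernel_prod_right' (κ := p.act t)
      (P.measurable_softQ T π t).stronglyMeasurable).measurable
  have key : ∀ {g : S × Belief Θ → ℝ}, Measurable g → (∀ x, |g x| ≤ B) →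
      ENNReal.ofReal (B - ∫ x, g x ∂(P.stateLaw p t)) =
        ∫⁻ x, ENNReal.ofReal (B - g x) ∂(P.stateLaw p t) := by
    intro g hg hgB
    have hi := integrable_of_forall_abs_le (μ := P.stateLaw p t) hg hgB
    rw [← ofReal_integral_eq_lintegral_ofReal (f := fun x => B - g x)
      ((integrable_const B).sub hi)
      (ae_of_all _ fun x => sub_nonneg.2 (abs_le.1 (hgB x)).2),
      integral_sub (integrable_const B) hi]
    simp
  rw [key hQm fun x => abs_integral_le_of_forall_abs_le fun a => hQB t (x, a),
    key (P.measurable_softValue T π t) (hVB t),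
    ← lintegral_add_right _ (hQm.const_sub B).ennreal_ofReal,
    ← lintegral_add_right _ ((P.measurable_softValue T π t).const_sub B).ennreal_ofReal]
  refine lintegral_congr fun x => ?_
  rw [improve_act, P.softValue_of_lt π ht]
  exact klDiv_add_ofReal_eq_klDiv_tilted_add
    ((P.measurable_softQ T π t).comp measurable_prodMk_left) fun a => hQB t (x, a)

/-- The proxy objective is the soft value minus the divergence from the soft-optimal policy. -/
theorem proxy_eq_sub {P : BayesRL Θ S A} (hR : P.RewardsBounded) (T : ℕ) (p π : BAPolicy Θ S ν) :
    P.proxy T p π = ((∫ x, P.softValue T π 0 x ∂P.initLaw : ℝ) : EReal) -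
      (P.klCost T p (improve hR T π) : EReal) := by
  obtain ⟨B, -, hB⟩ := hR.exists_bound T ν
  have hVB : ∀ t x, |P.softValue T π t x| ≤ B := fun t => (hB π t).1
  have hQB : ∀ t z, |P.softQ T π t z| ≤ B := fun t => (hB π t).2
  have hJ := expReturn_eq_add_sum hR T p (P.measurable_softValue T π) hVB
    (P.softValue_horizon T π)
  have hsum := Finset.sum_congr (rfl : Finset.range T = Finset.range T) fun t ht =>
    lintegral_klDiv_add hR p π hVB hQB (Finset.mem_range.1 ht)
  have ha : ∀ t, 0 ≤ B - ∫ x, ∫ a, P.softQ T π t (x, a) ∂(p.act t x) ∂(P.stateLaw p t) :=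
    fun t => sub_nonneg.2 (abs_le.1 (abs_integral_le_of_forall_abs_le fun x =>
      abs_integral_le_of_forall_abs_le fun a => hQB t (x, a))).2
  have hv : ∀ t, 0 ≤ B - ∫ x, P.softValue T π t x ∂(P.stateLaw p t) :=
    fun t => sub_nonneg.2 (abs_le.1 (abs_integral_le_of_forall_abs_le (hVB t))).2
  rw [Finset.sum_add_distrib, Finset.sum_add_distrib,
    ← ENNReal.ofReal_sum_of_nonneg fun t _ => ha t,
    ← ENNReal.ofReal_sum_of_nonneg fun t _ => hv t] at hsum
  change P.klCost T p π + _ = P.klCost T p (improve hR T π) + _ at hsum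
  rw [proxy]
  -- The two costs are infinite together. Otherwise, the summed Gibbs identity cancels the
  -- performance-difference sum taken with `V` the soft value.
  by_cases htop : P.klCost T p π = ∞
  · have htop' : P.klCost T p (improve hR T π) = ∞ := by
      rw [htop, top_add] at hsum
      exact (ENNReal.add_eq_top.1 hsum.symm).resolve_right ENNReal.ofReal_ne_top
    rw [htop, htop']
    simp
  have htop' : P.klCost T p (improve hR T π) ≠ ∞ := by
    intro h
    rw [h, top_add] at hsum
    exact htop ((ENNReal.add_eq_top.1 hsum).resolve_right ENNReal.ofReal_ne_top)
  have h := congrArg ENNReal.toReal hsum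
  rw [ENNReal.toReal_add htop ENNReal.ofReal_ne_top, ENNReal.toReal_add htop' ENNReal.ofReal_ne_top,
    ENNReal.toReal_ofReal (Finset.sum_nonneg fun t _ => ha t),
    ENNReal.toReal_ofReal (Finset.sum_nonneg fun t _ => hv t)] at h
  rw [← EReal.coe_ennreal_toReal htop, ← EReal.coe_ennreal_toReal htop', ← EReal.coe_sub,
    ← EReal.coe_sub, EReal.coe_eq_coe_iff, hJ]
  simp only [Finset.sum_sub_distrib] at h ⊢
  simp only [softQ] at h
  linarith

theorem klCost_self (P : BayesRL Θ S A) (T : ℕ) (p : BAPolicy Θ S ν) : P.klCost T p p = 0 := by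
  simp [klCost, klDiv_self]

theorem proxy_improve {P : BayesRL Θ S A} (hR : P.RewardsBounded) (T : ℕ) (π : BAPolicy Θ S ν) :
    P.proxy T (improve hR T π) π = ((∫ x, P.softValue T π 0 x ∂P.initLaw : ℝ) : EReal) := by
  rw [proxy_eq_sub hR, klCost_self]
  simp

theorem proxy_le_expReturn (P : BayesRL Θ S A) (T : ℕ) (p π : BAPolicy Θ S ν) :
    P.proxy T p π ≤ P.expReturn T p :=
  EReal.sub_le_of_le_add (le_add_of_nonneg_right (EReal.coe_ennreal_nonneg _))

theorem proxy_self (P : BayesRL Θ S A) (T : ℕ) (p : BAPolicy Θ S ν) :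
    P.proxy T p p = P.expReturn T p := by
  simp [proxy, klCost_self]

theorem proxy_le_proxy_improve {P : BayesRL Θ S A} (hR : P.RewardsBounded) (T : ℕ)
    (p π : BAPolicy Θ S ν) : P.proxy T p π ≤ P.proxy T (improve hR T π) π := by
  rw [proxy_improve, proxy_eq_sub hR]
  exact EReal.sub_le_of_le_add (le_add_of_nonneg_right (EReal.coe_ennreal_nonneg _))

theorem integral_softValue_le_expReturn_improve {P : BayesRL Θ S A} (hR : P.RewardsBounded) (T : ℕ)
    (π : BAPolicy Θ S ν) :
    ∫ x, P.softValue T π 0 x ∂P.initLaw ≤ P.expReturn T (improve hR T π) := by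
  have := P.proxy_le_expReturn T (improve hR T π) π
  rwa [proxy_improve, EReal.coe_le_coe_iff] at this

/-- `improve` attains the soft value, so any other maximizer must attain it too and cannot diverge
from `improve`. -/
theorem klCost_improve_eq_zero {P : BayesRL Θ S A} (hR : P.RewardsBounded) {T : ℕ}
    {q π : BAPolicy Θ S ν} (h : ∀ p, P.proxy T p π ≤ P.proxy T q π) :
    P.klCost T q (improve hR T π) = 0 := by
  have := h (improve hR T π)
  rw [proxy_improve, proxy_eq_sub hR] at this
  exact EReal.eq_zero_of_coe_le_coe_sub this

/-- The choice `p = q` competes in the M-step at zero cost. -/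
theorem klCost_eq_zero_of_forall_proxy_le {P : BayesRL Θ S A} {T : ℕ} {q π : BAPolicy Θ S ν}
    (h : ∀ p, P.proxy T q p ≤ P.proxy T q π) : P.klCost T q π = 0 := by
  have := h q
  rw [proxy_self] at this
  exact EReal.eq_zero_of_coe_le_coe_sub this

theorem ae_act_eq_of_klCost_eq_zero [StandardBorelSpace A] {P : BayesRL Θ S A} {T : ℕ}
    {q π : BAPolicy Θ S ν} (h : P.klCost T q π = 0) {t : ℕ} (ht : t < T) :
    ∀ᵐ x ∂(P.stateLaw q t), q.act t x = π.act t x := by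
  rw [klCost, Finset.sum_eq_zero_iff] at h
  filter_upwards [(lintegral_eq_zero_iff (Kernel.measurable_klDiv _ _)).1
    (h t (Finset.mem_range.2 ht))] with x hx
  exact klDiv_eq_zero_iff.1 hx

theorem proxy_congr_right {P : BayesRL Θ S A} {T : ℕ} {p π π' : BAPolicy Θ S ν}
    (h : ∀ t < T, ∀ᵐ x ∂(P.stateLaw p t), π.act t x = π'.act t x) :
    P.proxy T p π = P.proxy T p π' := by
  have : P.klCost T p π = P.klCost T p π' := by
    refine Finset.sum_congr rfl fun t ht => lintegral_congr_ae ?_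
    filter_upwards [h t (Finset.mem_range.1 ht)] with x hx
    rw [hx]
  rw [proxy, proxy, this]

theorem improve_full {P : BayesRL Θ S A} (hR : P.RewardsBounded) {T : ℕ} {π : BAPolicy Θ S ν}
    (hfull : ∀ t < T, ∀ x, ν ≪ π.act t x) : ∀ t < T, ∀ x, ν ≪ (improve hR T π).act t x := by
  intro t ht x
  obtain ⟨B, -, hB⟩ := hR.exists_bound T ν
  rw [improve_act]
  exact (hfull t ht x).trans (absolutelyContinuous_tilted (integrable_exp_of_forall_abs_le
    ((P.measurable_softQ T π t).comp measurable_prodMk_left) fun a => (hB π t).2 (x, a)))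

/-- The canonical EM run, in which every step is exactly the soft-optimal policy. -/
noncomputable def softIterate {P : BayesRL Θ S A} (hR : P.RewardsBounded) (T : ℕ)
    (π₁ : BAPolicy Θ S ν) : ℕ → BAPolicy Θ S ν
  | 0 => π₁
  | i + 1 => improve hR T (softIterate hR T π₁ i)

theorem isEMRun_softIterate {P : BayesRL Θ S A} (hR : P.RewardsBounded) (T : ℕ)
    (π₁ : BAPolicy Θ S ν) : P.IsEMRun T (softIterate hR T π₁) (softIterate hR T π₁) :=
  fun _ => ⟨fun p => proxy_le_proxy_improve hR T p _, fun p =>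
    (P.proxy_le_expReturn T _ p).trans_eq (P.proxy_self T _).symm⟩

theorem softIterate_full {P : BayesRL Θ S A} (hR : P.RewardsBounded) {T : ℕ}
    {π₁ : BAPolicy Θ S ν} (hfull : ∀ t < T, ∀ x, ν ≪ π₁.act t x) (i : ℕ) :
    ∀ t < T, ∀ x, ν ≪ (softIterate hR T π₁ i).act t x := by
  induction i with
  | zero => exact hfull
  | succ _ ih => exact improve_full hR ih

/-- Every EM run agrees with the canonical one on almost all reachable states. -/
theorem IsEMRun.ae_act_eq_softIterate [StandardBorelSpace A] {P : BayesRL Θ S A}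
    (hR : P.RewardsBounded) {T : ℕ} {π q : ℕ → BAPolicy Θ S ν}
    (hfull : ∀ t < T, ∀ x, ν ≪ (π 0).act t x) (hrun : P.IsEMRun T π q) (i : ℕ)
    (p : BAPolicy Θ S ν) {t : ℕ} (ht : t < T) :
    ∀ᵐ x ∂(P.stateLaw p t), (π i).act t x = (softIterate hR T (π 0) i).act t x := by
  induction i generalizing t p with
  | zero => exact ae_of_all _ fun x => rfl
  | succ i ih =>
    set σ := softIterate hR T (π 0) i
    have hq : P.klCost T (q (i + 1)) (improve hR T σ) = 0 := by
      refine klCost_improve_eq_zero hR fun p => ?_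
      -- The induction hypothesis holds under every policy's state law, so replacing the prior `π i`
      -- by `σ` changes no proxy value.
      rw [← proxy_congr_right fun t ht => ih p ht, ← proxy_congr_right fun t ht => ih (q (i + 1)) ht]
      exact (hrun i).1 p
    have h1 := fun t ht => ae_act_eq_of_klCost_eq_zero (t := t) hq ht
    have h2 := ae_act_eq_of_klCost_eq_zero (klCost_eq_zero_of_forall_proxy_le (hrun i).2) ht
    -- `q (i + 1)` visits states with the law of the full-support policy `improve hR T σ`, which
    -- dominates the law under `p`; this carries both equalities over to `p`.
    have hlaw := P.stateLaw_congr h1 ht.le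
    have hac := P.absolutelyContinuous_stateLaw
      (improve_full hR (softIterate_full hR hfull i)) p ht.le
    rw [← hlaw] at hac
    filter_upwards [hac.ae_le (h1 t ht), hac.ae_le h2] with x hx1 hx2
    rw [← hx2, hx1]
    rfl

end SoftValue

end BayesRL

/-- The tilted mean of `exp f` is `E[exp (2f)] / E[exp f]`, so the claim is nonnegativity of the
variance of `exp f`. -/
theorem MeasureTheory.integral_exp_le_integral_exp_tilted {α : Type*} [MeasurableSpace α]
    {μ : Measure α} [IsProbabilityMeasure μ] {f : α → ℝ} {B : ℝ} (hf : Measurable f)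
    (hB : ∀ x, |f x| ≤ B) :
    ∫ x, Real.exp (f x) ∂μ ≤ ∫ x, Real.exp (f x) ∂(μ.tilted f) := by
  have hi := integrable_exp_of_forall_abs_le (μ := μ) hf hB
  have hi2 : Integrable (fun x => Real.exp ((f + f) x)) μ :=
    integrable_exp_of_forall_abs_le (B := B + B) (hf.add hf) fun x =>
      (abs_add_le _ _).trans (add_le_add (hB x) (hB x))
  rw [integral_exp_tilted, le_div_iff₀ (integral_exp_pos hi)]
  set Z := ∫ x, Real.exp (f x) ∂μ with hZ
  have h : 0 ≤ ∫ x, (Real.exp ((f + f) x) - 2 * Z * Real.exp (f x) + Z ^ 2) ∂μ := by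
    refine integral_nonneg fun x => ?_
    simp only [Pi.add_apply, Real.exp_add, Pi.zero_apply]
    nlinarith [sq_nonneg (Real.exp (f x) - Z)]
  rw [integral_add (f := fun x => Real.exp ((f + f) x) - 2 * Z * Real.exp (f x))
      (hi2.sub (hi.const_mul _)) (integrable_const _), integral_sub hi2 (hi.const_mul _),
    integral_const_mul, ← hZ, integral_const, probReal_univ,
    one_smul] at h
  linarith

/-- A partial sum is `n` times a Cesàro mean, and the means tend to `l > 0`. -/
theorem Filter.Tendsto.sum_range_atTop {u : ℕ → ℝ} {l : ℝ} (h : Tendsto u atTop (𝓝 l))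
    (hl : 0 < l) : Tendsto (fun n => ∑ j ∈ Finset.range n, u j) atTop atTop := by
  refine (tendsto_natCast_atTop_atTop.atTop_mul_pos hl h.cesaro).congr fun n => ?_
  rcases eq_or_ne n 0 with rfl | hn
  · simp
  · field_simp

theorem Filter.Tendsto.sum_range_atBot {u : ℕ → ℝ} {l : ℝ} (h : Tendsto u atTop (𝓝 l))
    (hl : l < 0) : Tendsto (fun n => ∑ j ∈ Finset.range n, u j) atTop atBot := by
  rw [← tendsto_neg_atTop_iff]
  exact (h.neg.sum_range_atTop (neg_pos.2 hl)).congr fun n => by simp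

/-! ### Monotone limits of soft values and the optimal return. -/

namespace BayesRL

section OptimalValue

variable {Θ S A : Type*} [MeasurableSpace Θ] [MeasurableSpace S] [MeasurableSpace A]
  [StandardBorelSpace Θ] [Nonempty Θ] [StandardBorelSpace S] {ν : Measure A}

/-- Backward induction with two gains: tilting raises the mean of `exp Q`, and larger continuation
values raise `Q` itself. -/
theorem softValue_le_softValue_improve {P : BayesRL Θ S A} (hR : P.RewardsBounded) (T : ℕ)
    (π : BAPolicy Θ S ν) (t : ℕ) (x : S × Belief Θ) :
    P.softValue T π t x ≤ P.softValue T (improve hR T π) t x := by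
  obtain ⟨B, -, hB⟩ := hR.exists_bound T ν
  induction hn : T - t generalizing t x with
  | zero => simp [softValue, hn, softValueToGo]
  | succ n ih =>
    have ht : t < T := by lia
    have hm : ∀ π : BAPolicy Θ S ν, Measurable fun a => P.softQ T π t (x, a) := fun π =>
      (P.measurable_softQ T π t).comp measurable_prodMk_left
    have hQ : ∀ a, P.softQ T π t (x, a) ≤ P.softQ T (improve hR T π) t (x, a) := fun a =>
      P.lookahead_mono (P.measurable_softValue T π _) (P.measurable_softValue T _ _)
        (hB π _).1 (hB _ _).1 (fun y => ih (t + 1) y (by lia)) (x, a)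
    rw [P.softValue_of_lt π ht, P.softValue_of_lt _ ht]
    refine Real.log_le_log (integral_exp_pos (integrable_exp_of_forall_abs_le (hm π)
      fun a => (hB π t).2 (x, a))) ?_
    refine (integral_exp_le_integral_exp_tilted (hm π) fun a => (hB π t).2 (x, a)).trans ?_
    rw [← improve_act hR]
    exact integral_mono (integrable_exp_of_forall_abs_le (hm π) fun a => (hB π t).2 (x, a))
      (integrable_exp_of_forall_abs_le (hm _) fun a => (hB _ t).2 (x, a))
      fun a => Real.exp_le_exp.2 (hQ a)

/-- The limit of the soft values along the canonical EM run. -/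
noncomputable def optValue {P : BayesRL Θ S A} (hR : P.RewardsBounded) (T : ℕ)
    (π₁ : BAPolicy Θ S ν) (t : ℕ) (x : S × Belief Θ) : ℝ :=
  ⨆ i, P.softValue T (softIterate hR T π₁ i) t x

/-- The limit of the soft state-action values along the canonical EM run. -/
noncomputable def optQ {P : BayesRL Θ S A} (hR : P.RewardsBounded) (T : ℕ)
    (π₁ : BAPolicy Θ S ν) (t : ℕ) : (S × Belief Θ) × A → ℝ :=
  P.lookahead (optValue hR T π₁ (t + 1))

variable {P : BayesRL Θ S A} (hR : P.RewardsBounded) (T : ℕ) (π₁ : BAPolicy Θ S ν)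

theorem bddAbove_range_softValue (t : ℕ) (x : S × Belief Θ) :
    BddAbove (Set.range fun i => P.softValue T (softIterate hR T π₁ i) t x) := by
  obtain ⟨B, -, hB⟩ := hR.exists_bound T ν
  exact ⟨B, Set.forall_mem_range.2 fun i => (abs_le.1 ((hB _ t).1 x)).2⟩

theorem softValue_le_optValue (i t : ℕ) (x : S × Belief Θ) :
    P.softValue T (softIterate hR T π₁ i) t x ≤ optValue hR T π₁ t x :=
  le_ciSup (bddAbove_range_softValue hR T π₁ t x) i

theorem tendsto_softValue (t : ℕ) (x : S × Belief Θ) :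
    Tendsto (fun i => P.softValue T (softIterate hR T π₁ i) t x) atTop
      (𝓝 (optValue hR T π₁ t x)) :=
  tendsto_atTop_ciSup
    (monotone_nat_of_le_succ fun _ => softValue_le_softValue_improve hR T _ t x)
    (bddAbove_range_softValue hR T π₁ t x)

theorem measurable_optValue (t : ℕ) : Measurable (optValue hR T π₁ t) :=
  measurable_of_tendsto_metrizable (fun i => P.measurable_softValue T (softIterate hR T π₁ i) t)
    (tendsto_pi_nhds.2 fun x => tendsto_softValue hR T π₁ t x)

theorem measurable_optQ (t : ℕ) : Measurable (optQ hR T π₁ t) :=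
  P.measurable_lookahead (measurable_optValue hR T π₁ _)

theorem optValue_horizon (x : S × Belief Θ) : optValue hR T π₁ T x = 0 := by
  simp [optValue, softValue_horizon]

theorem exists_abs_optValue_le : ∃ B, ∀ t x, |optValue hR T π₁ t x| ≤ B := by
  obtain ⟨B, -, hB⟩ := hR.exists_bound T ν
  exact ⟨B, fun t x => le_of_tendsto' (tendsto_softValue hR T π₁ t x).abs fun i => (hB _ t).1 x⟩

theorem exists_abs_optQ_le : ∃ B, ∀ t z, |optQ hR T π₁ t z| ≤ B := by
  obtain ⟨B, hB⟩ := exists_abs_optValue_le hR T π₁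
  obtain ⟨C, -, hC⟩ := hR.exists_abs_meanReward_le
  exact ⟨C + B, fun t => abs_lookahead_le hC (hB _)⟩

theorem softQ_le_optQ (i t : ℕ) (z : (S × Belief Θ) × A) :
    P.softQ T (softIterate hR T π₁ i) t z ≤ optQ hR T π₁ t z := by
  obtain ⟨B, -, hB⟩ := hR.exists_bound T ν
  obtain ⟨B', hB'⟩ := exists_abs_optValue_le hR T π₁
  exact add_le_add_right (integral_mono
    (integrable_of_forall_abs_le (P.measurable_softValue T _ _) (hB _ _).1)
    (integrable_of_forall_abs_le (measurable_optValue hR T π₁ _) (hB' _))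
    fun y => softValue_le_optValue hR T π₁ i (t + 1) y) _

theorem tendsto_softQ (t : ℕ) (z : (S × Belief Θ) × A) :
    Tendsto (fun i => P.softQ T (softIterate hR T π₁ i) t z) atTop (𝓝 (optQ hR T π₁ t z)) := by
  obtain ⟨B, -, hB⟩ := hR.exists_bound T ν
  refine tendsto_const_nhds.add (tendsto_integral_of_dominated_convergence (fun _ => B)
    (fun i => (P.measurable_softValue T _ _).aestronglyMeasurable) (integrable_const B)
    (fun i => ae_of_all _ fun y => (hB _ _).1 y)
    (ae_of_all _ fun y => tendsto_softValue hR T π₁ (t + 1) y))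

/-- Log-likelihood ratio between the `i`-th canonical iterate and the initial policy. -/
noncomputable def logRatio (t i : ℕ) (z : (S × Belief Θ) × A) : ℝ :=
  ∑ j ∈ Finset.range i, (P.softQ T (softIterate hR T π₁ j) t z -
    P.softValue T (softIterate hR T π₁ j) t z.1)

theorem measurable_logRatio (t i : ℕ) : Measurable (logRatio hR T π₁ t i) :=
  Finset.measurable_sum _ fun _ _ => (P.measurable_softQ T _ t).sub
    ((P.measurable_softValue T _ t).comp measurable_fst)

variable {T}

/-- Successive tilts multiply, and the normalizer at each step is the exponential of the soft value.
-/
theorem softIterate_act (i : ℕ) {t : ℕ} (ht : t < T) (x : S × Belief Θ) :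
    (softIterate hR T π₁ i).act t x = (π₁.act t x).withDensity
      fun a => ENNReal.ofReal (Real.exp (logRatio hR T π₁ t i (x, a))) := by
  obtain ⟨B, -, hB⟩ := hR.exists_bound T ν
  induction i with
  | zero => simp [softIterate, logRatio]
  | succ i ih =>
    set σ := softIterate hR T π₁ i with hσ
    have hQm : Measurable fun a => P.softQ T σ t (x, a) :=
      (P.measurable_softQ T σ t).comp measurable_prodMk_left
    have hpos : 0 < ∫ a, Real.exp (P.softQ T σ t (x, a)) ∂(σ.act t x) :=
      integral_exp_pos (integrable_exp_of_forall_abs_le hQm fun a => (hB σ t).2 (x, a))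
    have hZ : ∫ a, Real.exp (P.softQ T σ t (x, a)) ∂(σ.act t x) =
        Real.exp (P.softValue T σ t x) := by
      rw [P.softValue_of_lt σ ht, Real.exp_log hpos]
    have hlm : Measurable fun a => ENNReal.ofReal (Real.exp (logRatio hR T π₁ t i (x, a))) :=
      ((measurable_logRatio hR T π₁ t i).comp measurable_prodMk_left).exp.ennreal_ofReal
    rw [softIterate, ← hσ, improve_act, Measure.tilted, hZ, ih, ← withDensity_mul _ hlm
      ((hQm.exp.div_const _).ennreal_ofReal)]
    congr 1
    ext a
    rw [Pi.mul_apply, ← ENNReal.ofReal_mul (Real.exp_pos _).le, ← Real.exp_sub, ← Real.exp_add,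
      logRatio, logRatio, Finset.sum_range_succ]

theorem lintegral_exp_logRatio (i : ℕ) {t : ℕ} (ht : t < T) (x : S × Belief Θ) :
    ∫⁻ a, ENNReal.ofReal (Real.exp (logRatio hR T π₁ t i (x, a))) ∂(π₁.act t x) = 1 := by
  have := measure_univ (μ := (softIterate hR T π₁ i).act t x)
  rwa [softIterate_act hR π₁ i ht, withDensity_apply _ MeasurableSet.univ,
    Measure.restrict_univ] at this

theorem tendsto_softQ_sub_softValue (t : ℕ) (z : (S × Belief Θ) × A) :
    Tendsto (fun i => P.softQ T (softIterate hR T π₁ i) t z -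
      P.softValue T (softIterate hR T π₁ i) t z.1) atTop
      (𝓝 (optQ hR T π₁ t z - optValue hR T π₁ t z.1)) :=
  (tendsto_softQ hR T π₁ t z).sub (tendsto_softValue hR T π₁ t z.1)

/-- Where `Q* > V*` the densities blow up, since their logarithms are sums of increments with a
positive limit. All densities have integral one, so by Fatou this happens only on a null set. -/
theorem ae_optQ_le_optValue {t : ℕ} (ht : t < T) (x : S × Belief Θ) :
    ∀ᵐ a ∂(π₁.act t x), optQ hR T π₁ t (x, a) ≤ optValue hR T π₁ t x := by
  set f : ℕ → A → ℝ≥0∞ := fun i a =>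
    ENNReal.ofReal (Real.exp (logRatio hR T π₁ t i (x, a))) with hf
  have hfm : ∀ i, Measurable (f i) := fun i =>
    ((measurable_logRatio hR T π₁ t i).comp measurable_prodMk_left).exp.ennreal_ofReal
  have hle : ∫⁻ a, liminf (fun i => f i a) atTop ∂(π₁.act t x) ≤ 1 :=
    (lintegral_liminf_le hfm).trans_eq (by simp [hf, lintegral_exp_logRatio hR π₁ _ ht])
  filter_upwards [ae_lt_top (Measurable.liminf hfm) (hle.trans_lt ENNReal.one_lt_top).ne] with a ha
  by_contra! hlt
  have h : Tendsto (fun i => f i a) atTop (𝓝 ∞) :=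
    ENNReal.tendsto_ofReal_atTop.comp (Real.tendsto_exp_atTop.comp
      ((tendsto_softQ_sub_softValue hR π₁ t (x, a)).sum_range_atTop (sub_pos.2 hlt)))
  exact ha.ne h.liminf_eq

/-- Performance difference against `V*`: every summand is nonpositive because `p ≪ ν ≪ π₁` transfers
`Q* ≤ V*` to the actions of `p`. -/
theorem expReturn_le_integral_optValue (hfull : ∀ t < T, ∀ x, ν ≪ π₁.act t x)
    (p : BAPolicy Θ S ν) : P.expReturn T p ≤ ∫ x, optValue hR T π₁ 0 x ∂P.initLaw := by
  obtain ⟨B, hB⟩ := exists_abs_optValue_le hR T π₁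
  obtain ⟨B', hB'⟩ := exists_abs_optQ_le hR T π₁
  rw [expReturn_eq_add_sum hR T p (measurable_optValue hR T π₁) hB (optValue_horizon hR T π₁),
    add_le_iff_nonpos_right]
  refine Finset.sum_nonpos fun t ht => sub_nonpos.2 ?_
  rw [Finset.mem_range] at ht
  refine integral_mono (integrable_of_forall_abs_le (StronglyMeasurable.integral_kernel_prod_right'
      (κ := p.act t) (measurable_optQ hR T π₁ t).stronglyMeasurable).measurable
      fun x => abs_integral_le_of_forall_abs_le fun a => hB' t (x, a))
    (integrable_of_forall_abs_le (measurable_optValue hR T π₁ t) (hB t)) fun x => ?_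
  have hle := ((p.hasDensity t x).trans (hfull t ht x)).ae_le (ae_optQ_le_optValue hR π₁ ht x)
  have := integral_mono_ae (integrable_of_forall_abs_le
    ((measurable_optQ hR T π₁ t).comp measurable_prodMk_left) fun a => hB' t (x, a))
    (integrable_const (μ := p.act t x) (optValue hR T π₁ t x)) hle
  simpa [optQ] using this

theorem expReturn_eq_integral_optValue {p : BAPolicy Θ S ν}
    (hp : ∀ t < T, ∀ x, ∀ᵐ a ∂(p.act t x), optQ hR T π₁ t (x, a) = optValue hR T π₁ t x) :
    P.expReturn T p = ∫ x, optValue hR T π₁ 0 x ∂P.initLaw := by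
  obtain ⟨B, hB⟩ := exists_abs_optValue_le hR T π₁
  rw [expReturn_eq_add_sum hR T p (measurable_optValue hR T π₁) hB (optValue_horizon hR T π₁),
    add_eq_left]
  refine Finset.sum_eq_zero fun t ht => sub_eq_zero.2 (integral_congr_ae (ae_of_all _ fun x => ?_))
  have := integral_congr_ae (hp t (Finset.mem_range.1 ht) x)
  simpa [optQ] using this

theorem isBayesOptimal_of_ae_optQ_eq (hfull : ∀ t < T, ∀ x, ν ≪ π₁.act t x)
    {p : BAPolicy Θ S ν}
    (hp : ∀ t < T, ∀ x, ∀ᵐ a ∂(p.act t x), optQ hR T π₁ t (x, a) = optValue hR T π₁ t x) :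
    P.IsBayesOptimal T p := fun p' => by
  rw [expReturn_eq_integral_optValue hR π₁ hp]
  exact expReturn_le_integral_optValue hR π₁ hfull p'

theorem tendsto_expReturn_softIterate (hfull : ∀ t < T, ∀ x, ν ≪ π₁.act t x) :
    Tendsto (fun i => P.expReturn T (softIterate hR T π₁ i)) atTop
      (𝓝 (∫ x, optValue hR T π₁ 0 x ∂P.initLaw)) := by
  obtain ⟨B, -, hB⟩ := hR.exists_bound T ν
  -- The soft value of iterate `i` bounds from below the return of iterate `i + 1`.
  rw [← tendsto_add_atTop_iff_nat 1]
  refine tendsto_of_tendsto_of_tendsto_of_le_of_le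
    (tendsto_integral_of_dominated_convergence (fun _ => B)
      (fun i => (P.measurable_softValue T (softIterate hR T π₁ i) 0).aestronglyMeasurable)
      (integrable_const B) (fun i => ae_of_all _ fun y => (hB _ _).1 y)
      (ae_of_all _ fun y => tendsto_softValue hR T π₁ 0 y))
    tendsto_const_nhds (fun i => integral_softValue_le_expReturn_improve hR T _)
    fun i => expReturn_le_integral_optValue hR π₁ hfull _

theorem isLUB_integral_optValue (hfull : ∀ t < T, ∀ x, ν ≪ π₁.act t x) :
    IsLUB (Set.range fun p : BAPolicy Θ S ν => P.expReturn T p)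
      (∫ x, optValue hR T π₁ 0 x ∂P.initLaw) :=
  ⟨Set.forall_mem_range.2 (expReturn_le_integral_optValue hR π₁ hfull), fun _ hb =>
    le_of_tendsto' (tendsto_expReturn_softIterate hR π₁ hfull) fun _ => hb (Set.mem_range_self _)⟩

end OptimalValue

end BayesRL

/-! ### Concentration on optimal actions. -/

theorem BAPolicy.ae_reweight_act {Θ S A : Type*} [MeasurableSpace Θ] [MeasurableSpace S]
    [MeasurableSpace A] {ν : Measure A} (π : BAPolicy Θ S ν)
    (f : ℕ → (S × Belief Θ) × A → ℝ≥0∞) (hf : ∀ t, Measurable (f t))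
    (h1 : ∀ t x, ∫⁻ a, f t (x, a) ∂(π.act t x) = 1) (t : ℕ) (x : S × Belief Θ) {r : A → Prop}
    (hr : ∀ a, f t (x, a) ≠ 0 → r a) : ∀ᵐ a ∂((π.reweight f hf h1).act t x), r a := by
  rw [BAPolicy.reweight_act, ae_withDensity_iff (f := fun a => f t (x, a))
    ((hf t).comp measurable_prodMk_left)]
  exact ae_of_all _ hr

namespace BayesRL

section Greedy

variable {Θ S A : Type*} [MeasurableSpace Θ] [MeasurableSpace S] [MeasurableSpace A]
  [StandardBorelSpace Θ] [Nonempty Θ] [StandardBorelSpace S] {ν : Measure A}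
  {P : BayesRL Θ S A} (hR : P.RewardsBounded)

/-- The state-action pairs whose action is optimal in its state. -/
def greedySet (T : ℕ) (π₁ : BAPolicy Θ S ν) (t : ℕ) : Set ((S × Belief Θ) × A) :=
  {z | optQ hR T π₁ t z = optValue hR T π₁ t z.1}

theorem measurableSet_greedySet (T : ℕ) (π₁ : BAPolicy Θ S ν) (t : ℕ) :
    MeasurableSet (greedySet hR T π₁ t) :=
  measurableSet_eq_fun (measurable_optQ hR T π₁ t)
    ((measurable_optValue hR T π₁ t).comp measurable_fst)

variable {T : ℕ} {π₁ : BAPolicy Θ S ν}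

open Classical in
/-- Density relative to `π` of the policy `π` conditioned on optimal actions. -/
noncomputable def greedyDensity (T : ℕ) (π₁ π : BAPolicy Θ S ν) (t : ℕ) :
    (S × Belief Θ) × A → ℝ≥0∞ :=
  if t < T then (greedySet hR T π₁ t).indicator
    fun z => (π.act t z.1 (Prod.mk z.1 ⁻¹' greedySet hR T π₁ t))⁻¹
  -- Beyond the horizon optimal actions may carry no mass, so the policy is left unchanged.
  else 1

theorem measurable_greedyDensity (π : BAPolicy Θ S ν) (t : ℕ) :
    Measurable (greedyDensity hR T π₁ π t) := by
  unfold greedyDensity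
  split_ifs
  · exact (((Kernel.measurable_kernel_prodMk_left
      (measurableSet_greedySet hR T π₁ t)).comp measurable_fst).inv).indicator
      (measurableSet_greedySet hR T π₁ t)
  · exact measurable_const

theorem lintegral_greedyDensity {π : BAPolicy Θ S ν}
    (hπ : ∀ t < T, ∀ x, π.act t x (Prod.mk x ⁻¹' greedySet hR T π₁ t) ≠ 0) (t : ℕ)
    (x : S × Belief Θ) : ∫⁻ a, greedyDensity hR T π₁ π t (x, a) ∂(π.act t x) = 1 := by
  unfold greedyDensity
  split_ifs with ht
  · have h : ∀ a, (greedySet hR T π₁ t).indicator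
        (fun z => (π.act t z.1 (Prod.mk z.1 ⁻¹' greedySet hR T π₁ t))⁻¹) (x, a) =
        (Prod.mk x ⁻¹' greedySet hR T π₁ t).indicator
          (fun _ => (π.act t x (Prod.mk x ⁻¹' greedySet hR T π₁ t))⁻¹) a := fun a => rfl
    simp_rw [h]
    rw [lintegral_indicator_const (measurable_prodMk_left (measurableSet_greedySet hR T π₁ t)),
      ENNReal.inv_mul_cancel (hπ t ht x) (measure_ne_top _ _)]
  · simp

theorem mem_greedySet_of_greedyDensity_ne_zero (π : BAPolicy Θ S ν) {t : ℕ} (ht : t < T)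
    {z : (S × Belief Θ) × A} (hz : greedyDensity hR T π₁ π t z ≠ 0) :
    z ∈ greedySet hR T π₁ t := by
  rw [greedyDensity, if_pos ht] at hz
  exact Set.mem_of_indicator_ne_zero hz

/-- The policy `π` conditioned on optimal actions. -/
noncomputable def greedy (π : BAPolicy Θ S ν)
    (hπ : ∀ t < T, ∀ x, π.act t x (Prod.mk x ⁻¹' greedySet hR T π₁ t) ≠ 0) : BAPolicy Θ S ν :=
  π.reweight (greedyDensity hR T π₁ π) (measurable_greedyDensity hR π)
    (lintegral_greedyDensity hR hπ)

theorem isBayesOptimal_greedy (hfull : ∀ t < T, ∀ x, ν ≪ π₁.act t x) {π : BAPolicy Θ S ν}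
    (hπ : ∀ t < T, ∀ x, π.act t x (Prod.mk x ⁻¹' greedySet hR T π₁ t) ≠ 0) :
    P.IsBayesOptimal T (greedy hR π hπ) :=
  isBayesOptimal_of_ae_optQ_eq hR π₁ hfull fun t ht x =>
    π.ae_reweight_act _ _ _ t x fun _ ha => mem_greedySet_of_greedyDensity_ne_zero hR π ht ha

theorem optQ_le_optValue_of_ne_zero {t : ℕ} (ht : t < T) {x : S × Belief Θ} {a : A}
    (ha : π₁.act t x {a} ≠ 0) : optQ hR T π₁ t (x, a) ≤ optValue hR T π₁ t x := by
  by_contra h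
  exact ha (measure_mono_null (Set.singleton_subset_iff.2 h) (ae_optQ_le_optValue hR π₁ ht x))

theorem tendsto_exp_logRatio_of_lt {t : ℕ} {z : (S × Belief Θ) × A}
    (h : optQ hR T π₁ t z < optValue hR T π₁ t z.1) :
    Tendsto (fun i => ENNReal.ofReal (Real.exp (logRatio hR T π₁ t i z))) atTop (𝓝 0) := by
  rw [← ENNReal.ofReal_zero]
  exact ENNReal.tendsto_ofReal (Real.tendsto_exp_atBot.comp
    ((tendsto_softQ_sub_softValue hR π₁ t z).sum_range_atBot (sub_neg.2 h)))

section Finite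

variable [MeasurableSingletonClass A]

theorem greedy_act_singleton {π : BAPolicy Θ S ν}
    (hπ : ∀ t < T, ∀ x, π.act t x (Prod.mk x ⁻¹' greedySet hR T π₁ t) ≠ 0) {t : ℕ} (ht : t < T)
    (x : S × Belief Θ) (a : A) : (greedy hR π hπ).act t x {a} =
      (greedySet hR T π₁ t).indicator
        (fun z => (π.act t z.1 (Prod.mk z.1 ⁻¹' greedySet hR T π₁ t))⁻¹) (x, a) *
        π.act t x {a} := by
  rw [greedy, BAPolicy.reweight_act, withDensity_apply _ (measurableSet_singleton a),
    lintegral_singleton, greedyDensity, if_pos ht]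

theorem softIterate_act_singleton (i : ℕ) {t : ℕ} (ht : t < T) (x : S × Belief Θ) (a : A) :
    (softIterate hR T π₁ i).act t x {a} =
      ENNReal.ofReal (Real.exp (logRatio hR T π₁ t i (x, a))) * π₁.act t x {a} := by
  rw [softIterate_act hR π₁ i ht, withDensity_apply _ (measurableSet_singleton a),
    lintegral_singleton]

theorem tendsto_softIterate_act_singleton_of_notMem {t : ℕ} (ht : t < T) {x : S × Belief Θ} {a : A}
    (h : (x, a) ∉ greedySet hR T π₁ t) :
    Tendsto (fun i => (softIterate hR T π₁ i).act t x {a}) atTop (𝓝 0) := by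
  simp_rw [softIterate_act_singleton hR _ ht]
  by_cases ha : π₁.act t x {a} = 0
  · simp [ha]
  · simpa using ENNReal.Tendsto.mul_const (b := π₁.act t x {a}) (tendsto_exp_logRatio_of_lt hR
      (lt_of_le_of_ne (optQ_le_optValue_of_ne_zero hR ht ha) h)) (Or.inr (measure_ne_top _ _))

variable [Finite A]

theorem tendsto_softIterate_act_compl_greedySet {t : ℕ} (ht : t < T) (x : S × Belief Θ) :
    Tendsto (fun i => (softIterate hR T π₁ i).act t x (Prod.mk x ⁻¹' greedySet hR T π₁ t)ᶜ)
      atTop (𝓝 0) := by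
  have hfin := Set.toFinite (Prod.mk x ⁻¹' greedySet hR T π₁ t)ᶜ
  have h : ∀ i, (softIterate hR T π₁ i).act t x (Prod.mk x ⁻¹' greedySet hR T π₁ t)ᶜ =
      ∑ a ∈ hfin.toFinset, (softIterate hR T π₁ i).act t x {a} := fun i => by
    rw [sum_measure_singleton, hfin.coe_toFinset]
  simp_rw [h]
  rw [← Finset.sum_const_zero (ι := A) (s := hfin.toFinset)]
  refine tendsto_finsetSum _ fun a ha => ?_
  exact tendsto_softIterate_act_singleton_of_notMem hR ht (hfin.mem_toFinset.1 ha)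

theorem tendsto_softIterate_act_greedySet {t : ℕ} (ht : t < T) (x : S × Belief Θ) :
    Tendsto (fun i => (softIterate hR T π₁ i).act t x (Prod.mk x ⁻¹' greedySet hR T π₁ t))
      atTop (𝓝 1) := by
  have hm : MeasurableSet (Prod.mk x ⁻¹' greedySet hR T π₁ t) :=
    measurable_prodMk_left (measurableSet_greedySet hR T π₁ t)
  have h := ENNReal.Tendsto.sub (tendsto_const_nhds (x := (1 : ℝ≥0∞)))
    (tendsto_softIterate_act_compl_greedySet hR (π₁ := π₁) ht x) (Or.inl ENNReal.one_ne_top)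
  rw [tsub_zero] at h
  refine h.congr fun i => ?_
  rw [← prob_compl_eq_one_sub hm.compl, compl_compl]

/-- All iterates have densities relative to `π₁`; if `π₁` gave optimal actions no mass, neither
would any iterate, yet their mass there tends to one. -/
theorem exists_optimal_action {t : ℕ} (ht : t < T) (x : S × Belief Θ) :
    ∃ a, (x, a) ∈ greedySet hR T π₁ t ∧ π₁.act t x {a} ≠ 0 := by
  by_contra! h
  have h0 : ∀ i, (softIterate hR T π₁ i).act t x (Prod.mk x ⁻¹' greedySet hR T π₁ t) = 0 := by
    intro i
    have hfin := Set.toFinite (Prod.mk x ⁻¹' greedySet hR T π₁ t)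
    rw [← hfin.coe_toFinset, ← sum_measure_singleton]
    refine Finset.sum_eq_zero fun a ha => ?_
    rw [softIterate_act_singleton hR i ht, h a (hfin.mem_toFinset.1 ha), mul_zero]
  have := tendsto_softIterate_act_greedySet hR (π₁ := π₁) ht x
  simp_rw [h0] at this
  exact zero_ne_one (tendsto_nhds_unique tendsto_const_nhds this)

theorem act_greedySet_ne_zero {π : BAPolicy Θ S ν} (hπ : ∀ t < T, ∀ x, ν ≪ π.act t x) :
    ∀ t < T, ∀ x, π.act t x (Prod.mk x ⁻¹' greedySet hR T π₁ t) ≠ 0 := by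
  intro t ht x h
  obtain ⟨a, ha, hne⟩ := exists_optimal_action hR (π₁ := π₁) ht x
  exact hne (π₁.hasDensity t x (hπ t ht x (measure_mono_null (Set.singleton_subset_iff.2 ha) h)))

theorem tendsto_softIterate_sub_greedy (hfull : ∀ t < T, ∀ x, ν ≪ π₁.act t x) {t : ℕ} (ht : t < T)
    (x : S × Belief Θ) (a : A) :
    Tendsto (fun i => ((softIterate hR T π₁ i).act t x).real {a} -
      ((greedy hR (π₁ := π₁) (softIterate hR T π₁ i)
        (act_greedySet_ne_zero hR (softIterate_full hR hfull i))).act t x).real {a})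
      atTop (𝓝 0) := by
  simp_rw [Measure.real, greedy_act_singleton hR _ ht]
  by_cases h : (x, a) ∈ greedySet hR T π₁ t
  -- On an optimal action, conditioning divides by the mass `m_i` of the optimal set, so the
  -- difference is `1 - m_i⁻¹` times a probability, with `m_i → 1`.
  · have hg : Tendsto (fun i => 1 - ((softIterate hR T π₁ i).act t x
        (Prod.mk x ⁻¹' greedySet hR T π₁ t)).toReal⁻¹) atTop (𝓝 0) := by
      have := (ENNReal.tendsto_toReal ENNReal.one_ne_top).comp
        (tendsto_softIterate_act_greedySet hR (π₁ := π₁) ht x)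
      simpa using (this.inv₀ (by simp)).const_sub 1
    refine squeeze_zero_norm (fun i => ?_) (by simpa using hg.norm)
    rw [Set.indicator_of_mem h, ENNReal.toReal_mul, ENNReal.toReal_inv, ← one_sub_mul, norm_mul]
    refine mul_le_of_le_one_right (norm_nonneg _) ?_
    rw [Real.norm_of_nonneg ENNReal.toReal_nonneg]
    exact measureReal_le_one
  · simp_rw [Set.indicator_of_notMem h, zero_mul, ENNReal.toReal_zero, sub_zero]
    exact (ENNReal.tendsto_toReal ENNReal.zero_ne_top).comp
      (tendsto_softIterate_act_singleton_of_notMem hR ht h)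

end Finite

end Greedy

end BayesRL

/-! ### Uniformly positive initial policies: convergence to one policy. -/

namespace BayesRL

section UniformLowerBound

variable {Θ S A : Type*} [MeasurableSpace Θ] [MeasurableSpace S] [MeasurableSpace A]
  [StandardBorelSpace Θ] [Nonempty Θ] [StandardBorelSpace S] {ν : Measure A}
  {P : BayesRL Θ S A} (hR : P.RewardsBounded) (T : ℕ) (π₁ : BAPolicy Θ S ν)

/-- Accumulated gap between the limit value and the soft values of the first `n` iterates. -/
noncomputable def valueGap (t n : ℕ) (x : S × Belief Θ) : ℝ :=
  ∑ j ∈ Finset.range n, (optValue hR T π₁ t x - P.softValue T (softIterate hR T π₁ j) t x)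

/-- Accumulated gap between the limit state-action value and those of the first `n` iterates. -/
noncomputable def qGap (t n : ℕ) (z : (S × Belief Θ) × A) : ℝ :=
  ∑ j ∈ Finset.range n, (optQ hR T π₁ t z - P.softQ T (softIterate hR T π₁ j) t z)

theorem monotone_valueGap (t : ℕ) (x : S × Belief Θ) :
    Monotone fun n => valueGap hR T π₁ t n x :=
  monotone_nat_of_le_succ fun n => by
    rw [valueGap, valueGap, Finset.sum_range_succ]
    linarith [softValue_le_optValue hR T π₁ n t x]

theorem monotone_qGap (t : ℕ) (z : (S × Belief Θ) × A) : Monotone fun n => qGap hR T π₁ t n z :=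
  monotone_nat_of_le_succ fun n => by
    rw [qGap, qGap, Finset.sum_range_succ]
    linarith [softQ_le_optQ hR T π₁ n t z]

/-- On an optimal action the term linear in `n` disappears and a difference of two monotone
sequences remains, so convergence reduces to boundedness. -/
theorem logRatio_eq (t n : ℕ) (z : (S × Belief Θ) × A) : logRatio hR T π₁ t n z =
    n * (optQ hR T π₁ t z - optValue hR T π₁ t z.1) +
      (valueGap hR T π₁ t n z.1 - qGap hR T π₁ t n z) := by
  simp only [logRatio, valueGap, qGap, Finset.sum_sub_distrib, Finset.sum_const, Finset.card_range,
    nsmul_eq_mul]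
  ring

theorem integrable_softValue_gap (t j : ℕ) (μ : Measure (S × Belief Θ)) [IsFiniteMeasure μ] :
    Integrable (fun y => optValue hR T π₁ t y - P.softValue T (softIterate hR T π₁ j) t y) μ := by
  obtain ⟨B, -, hB⟩ := hR.exists_bound T ν
  obtain ⟨B', hB'⟩ := exists_abs_optValue_le hR T π₁
  exact (integrable_of_forall_abs_le (measurable_optValue hR T π₁ t) (hB' t)).sub
    (integrable_of_forall_abs_le (P.measurable_softValue T _ t) (hB _ t).1)

theorem integrable_valueGap (t n : ℕ) (μ : Measure (S × Belief Θ)) [IsFiniteMeasure μ] :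
    Integrable (valueGap hR T π₁ t n) μ :=
  integrable_finsetSum _ fun j _ => integrable_softValue_gap hR T π₁ t j μ

theorem qGap_eq_integral (t n : ℕ) (z : (S × Belief Θ) × A) :
    qGap hR T π₁ t n z = ∫ y, valueGap hR T π₁ (t + 1) n y ∂(P.transition z) := by
  obtain ⟨B, -, hB⟩ := hR.exists_bound T ν
  obtain ⟨B', hB'⟩ := exists_abs_optValue_le hR T π₁
  simp only [valueGap, qGap]
  rw [integral_finsetSum _ fun j _ => integrable_softValue_gap hR T π₁ (t + 1) j _]
  refine Finset.sum_congr rfl fun j _ => ?_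
  rw [integral_sub (integrable_of_forall_abs_le (measurable_optValue hR T π₁ _) (hB' _))
    (integrable_of_forall_abs_le (P.measurable_softValue T _ _) (hB _ _).1)]
  simp only [optQ, softQ, lookahead]
  ring

variable {T π₁}

theorem ae_qGap_le_of_ae_valueGap_le {ε c : ℝ} (hε : 0 < ε) {t : ℕ}
    (hlow : ∀ᵐ x ∂(P.stateLaw π₁ t), ∀ a, ε ≤ (π₁.act t x).real {a})
    (h : ∀ᵐ x ∂(P.stateLaw π₁ (t + 1)), ∀ n, valueGap hR T π₁ (t + 1) n x ≤ c) :
    ∀ᵐ x ∂(P.stateLaw π₁ t), ∀ a n, qGap hR T π₁ t n (x, a) ≤ c := by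
  filter_upwards [P.ae_stateLaw_succ π₁ h, hlow] with x hx hxε a n
  -- Every action has positive mass, so a property of almost every action holds for each action.
  have ha : ∀ᵐ y ∂(P.transition (x, a)), ∀ n, valueGap hR T π₁ (t + 1) n y ≤ c := by
    by_contra hcon
    have h0 : (π₁.act t x).real {a} = 0 := by
      rw [measureReal_eq_zero_iff]
      exact measure_mono_null (Set.singleton_subset_iff.2 hcon) hx
    linarith [hxε a]
  rw [qGap_eq_integral]
  have := integral_mono_ae (integrable_valueGap hR T π₁ (t + 1) n _)
    (integrable_const (μ := P.transition (x, a)) c) (ha.mono fun y hy => hy n)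
  simpa using this

variable [MeasurableSingletonClass A]

/-- The iterate gives `a` mass at most one and `π₁` gives it at least `ε`, so the density is at most
`1 / ε`. -/
theorem logRatio_le {ε : ℝ} (hε : 0 < ε) {t : ℕ} (ht : t < T) {x : S × Belief Θ} {a : A}
    (ha : ε ≤ (π₁.act t x).real {a}) (n : ℕ) : logRatio hR T π₁ t n (x, a) ≤ -Real.log ε := by
  have h := measureReal_le_one (μ := (softIterate hR T π₁ n).act t x) (s := {a})
  rw [Measure.real, softIterate_act_singleton hR n ht, ENNReal.toReal_mul,
    ENNReal.toReal_ofReal (Real.exp_pos _).le] at h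
  rw [← Real.log_inv, Real.le_log_iff_exp_le (inv_pos.2 hε), ← one_div, le_div_iff₀ hε]
  exact (mul_le_mul_of_nonneg_left ha (Real.exp_pos _).le).trans h

variable [Finite A]

/-- At an optimal action the value gap equals the log density plus the `Q`-gap. The former is at
most `-log ε`, and the latter averages the next epoch's value gap, so the bound grows by `-log ε`
per step backward from `T`. -/
theorem exists_ae_valueGap_le {ε : ℝ} (hε : 0 < ε)
    (hlow : ∀ t < T, ∀ᵐ x ∂(P.stateLaw π₁ t), ∀ a, ε ≤ (π₁.act t x).real {a}) {t : ℕ}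
    (ht : t ≤ T) : ∃ c, ∀ᵐ x ∂(P.stateLaw π₁ t), ∀ n, valueGap hR T π₁ t n x ≤ c := by
  induction ht using Nat.decreasingInduction with
  | self =>
    exact ⟨0, ae_of_all _ fun x n => by simp [valueGap, optValue_horizon, softValue_horizon]⟩
  | of_succ t ht ih =>
    obtain ⟨c, hc⟩ := ih
    refine ⟨c - Real.log ε, ?_⟩
    filter_upwards [ae_qGap_le_of_ae_valueGap_le hR hε (hlow t ht) hc, hlow t ht] with x hx hxε n
    obtain ⟨a, ha, -⟩ := exists_optimal_action hR (π₁ := π₁) ht x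
    have ha' : optQ hR T π₁ t (x, a) = optValue hR T π₁ t x := ha
    have h := logRatio_le hR hε ht (hxε a) n
    rw [logRatio_eq, ha', sub_self, mul_zero, zero_add] at h
    linarith [hx a n]

/-- Limit density of the canonical iterates relative to the initial policy. -/
noncomputable def limitDensity (T : ℕ) (π₁ : BAPolicy Θ S ν) (t : ℕ) :
    (S × Belief Θ) × A → ℝ≥0∞ :=
  (greedySet hR T π₁ t).indicator fun z =>
    -- A `limsup` is measurable without knowing convergence, which is established only almost
    -- everywhere.
    limsup (fun n => ENNReal.ofReal (Real.exp (logRatio hR T π₁ t n z))) atTop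

omit [Finite A] [MeasurableSingletonClass A] in
theorem measurable_limitDensity (t : ℕ) : Measurable (limitDensity hR T π₁ t) :=
  (Measurable.limsup fun n => (measurable_logRatio hR T π₁ t n).exp.ennreal_ofReal).indicator
    (measurableSet_greedySet hR T π₁ t)

theorem ae_tendsto_exp_logRatio {ε : ℝ} (hε : 0 < ε)
    (hlow : ∀ t < T, ∀ᵐ x ∂(P.stateLaw π₁ t), ∀ a, ε ≤ (π₁.act t x).real {a}) {t : ℕ}
    (ht : t < T) : ∀ᵐ x ∂(P.stateLaw π₁ t), ∀ a,
      Tendsto (fun n => ENNReal.ofReal (Real.exp (logRatio hR T π₁ t n (x, a)))) atTop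
        (𝓝 (limitDensity hR T π₁ t (x, a))) := by
  obtain ⟨c, hc⟩ := exists_ae_valueGap_le hR hε hlow ht.le
  obtain ⟨c', hc'⟩ := exists_ae_valueGap_le hR hε hlow (t := t + 1) ht
  filter_upwards [hc, ae_qGap_le_of_ae_valueGap_le hR hε (hlow t ht) hc', hlow t ht]
    with x hx hxq hxε a
  have hne : π₁.act t x {a} ≠ 0 := fun h0 => by
    have := hxε a
    rw [Measure.real, h0, ENNReal.toReal_zero] at this
    linarith
  by_cases ha : (x, a) ∈ greedySet hR T π₁ t
  · have ha' : optQ hR T π₁ t (x, a) = optValue hR T π₁ t x := ha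
    have hV := tendsto_atTop_ciSup (monotone_valueGap hR T π₁ t x)
      ⟨c, Set.forall_mem_range.2 hx⟩
    have hQ := tendsto_atTop_ciSup (monotone_qGap hR T π₁ t (x, a))
      ⟨c', Set.forall_mem_range.2 (hxq a)⟩
    have h : Tendsto (fun n => ENNReal.ofReal (Real.exp (logRatio hR T π₁ t n (x, a)))) atTop
        (𝓝 (ENNReal.ofReal (Real.exp ((⨆ n, valueGap hR T π₁ t n x) -
          ⨆ n, qGap hR T π₁ t n (x, a))))) := by
      refine ENNReal.tendsto_ofReal ((Real.continuous_exp.tendsto _).comp ?_)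
      simpa [logRatio_eq, ha'] using hV.sub hQ
    rwa [limitDensity, Set.indicator_of_mem ha, h.limsup_eq]
  · rw [limitDensity, Set.indicator_of_notMem ha]
    exact tendsto_exp_logRatio_of_lt hR
      (lt_of_le_of_ne (optQ_le_optValue_of_ne_zero hR ht hne) ha)

/-- With finitely many actions the integral is a finite sum, so total mass one survives the
pointwise limit. -/
theorem lintegral_limitDensity_eq_one {t : ℕ} (ht : t < T) {x : S × Belief Θ}
    (h : ∀ a, Tendsto (fun n => ENNReal.ofReal (Real.exp (logRatio hR T π₁ t n (x, a)))) atTop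
        (𝓝 (limitDensity hR T π₁ t (x, a)))) :
    ∫⁻ a, limitDensity hR T π₁ t (x, a) ∂(π₁.act t x) = 1 := by
  have := Fintype.ofFinite A
  have h' := tendsto_finsetSum (Finset.univ : Finset A) fun a _ =>
    ENNReal.Tendsto.mul_const (h a) (Or.inr (measure_ne_top (π₁.act t x) {a}))
  simp_rw [← lintegral_fintype, lintegral_exp_logRatio hR π₁ _ ht] at h'
  exact tendsto_nhds_unique h' tendsto_const_nhds

open Classical in
/-- Density of the limit policy: the limit density where it is a probability density, and that of
the greedy policy elsewhere. -/
noncomputable def limitPolicyDensity (T : ℕ) (π₁ : BAPolicy Θ S ν) (t : ℕ)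
    (z : (S × Belief Θ) × A) : ℝ≥0∞ :=
  if ∫⁻ a, limitDensity hR T π₁ t (z.1, a) ∂(π₁.act t z.1) = 1 then limitDensity hR T π₁ t z
  else greedyDensity hR T π₁ π₁ t z

omit [Finite A] [MeasurableSingletonClass A] in
theorem measurable_limitPolicyDensity (t : ℕ) : Measurable (limitPolicyDensity hR T π₁ t) :=
  Measurable.ite (((Measurable.lintegral_kernel_prod_right'
      (κ := π₁.act t) (measurable_limitDensity hR t)).comp measurable_fst)
        (measurableSet_singleton 1))
    (measurable_limitDensity hR t) (measurable_greedyDensity hR π₁ t)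

theorem lintegral_limitPolicyDensity (hfull : ∀ t < T, ∀ x, ν ≪ π₁.act t x) (t : ℕ)
    (x : S × Belief Θ) : ∫⁻ a, limitPolicyDensity hR T π₁ t (x, a) ∂(π₁.act t x) = 1 := by
  simp only [limitPolicyDensity]
  split_ifs with h
  · exact h
  · exact lintegral_greedyDensity hR (act_greedySet_ne_zero hR hfull) t x

/-- The limit of the canonical EM run. -/
noncomputable def limitPolicy (hfull : ∀ t < T, ∀ x, ν ≪ π₁.act t x) : BAPolicy Θ S ν :=
  π₁.reweight (limitPolicyDensity hR T π₁) (measurable_limitPolicyDensity hR)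
    (lintegral_limitPolicyDensity hR hfull)

/-- Both branches of the density vanish off the optimal actions, so optimality holds even at states
where convergence is unknown. -/
theorem isBayesOptimal_limitPolicy (hfull : ∀ t < T, ∀ x, ν ≪ π₁.act t x) :
    P.IsBayesOptimal T (limitPolicy hR hfull) :=
  isBayesOptimal_of_ae_optQ_eq hR π₁ hfull fun t ht x =>
    π₁.ae_reweight_act _ _ _ t x fun a ha => by
      unfold limitPolicyDensity at ha
      split_ifs at ha
      · exact Set.mem_of_indicator_ne_zero (s := greedySet hR T π₁ t) ha
      · exact mem_greedySet_of_greedyDensity_ne_zero hR π₁ ht ha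

theorem ae_tendsto_softIterate_limitPolicy (hfull : ∀ t < T, ∀ x, ν ≪ π₁.act t x) {ε : ℝ}
    (hε : 0 < ε) (hlow : ∀ t < T, ∀ᵐ x ∂(P.stateLaw π₁ t), ∀ a, ε ≤ (π₁.act t x).real {a}) {t : ℕ}
    (ht : t < T) : ∀ᵐ x ∂(P.stateLaw π₁ t), ∀ a,
      Tendsto (fun i => ((softIterate hR T π₁ i).act t x).real {a}) atTop
        (𝓝 (((limitPolicy hR hfull).act t x).real {a})) := by
  filter_upwards [ae_tendsto_exp_logRatio hR hε hlow ht] with x hx a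
  refine (ENNReal.tendsto_toReal (measure_ne_top _ _)).comp ?_
  rw [limitPolicy, BAPolicy.reweight_act, withDensity_apply _ (measurableSet_singleton a),
    lintegral_singleton, limitPolicyDensity, if_pos (lintegral_limitDensity_eq_one hR ht hx)]
  simp_rw [softIterate_act_singleton hR _ ht]
  exact ENNReal.Tendsto.mul_const (hx a) (Or.inr (measure_ne_top _ _))

end UniformLowerBound

end BayesRL

/-! ### From the canonical run to arbitrary runs. -/

theorem mainTheorem2 {Θ S A : Type*}
    [MeasurableSpace Θ] [StandardBorelSpace Θ] [Nonempty Θ]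
    [MeasurableSpace S] [StandardBorelSpace S]
    [MeasurableSpace A] [StandardBorelSpace A]
    (P : BayesRL Θ S A) (hR : P.RewardsBounded) (T : ℕ)
    (ν : Measure A) [SigmaFinite ν]
    (π₁ : BAPolicy Θ S ν) (hfull : ∀ t < T, ∀ x, ν ≪ π₁.act t x) :
    (∃ π q : ℕ → BAPolicy Θ S ν, π 0 = π₁ ∧ P.IsEMRun T π q) ∧
    ∀ π q : ℕ → BAPolicy Θ S ν, π 0 = π₁ → P.IsEMRun T π q →
      (∃ J : ℝ, IsLUB (Set.range fun p : BAPolicy Θ S ν => P.expReturn T p) J ∧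
        Tendsto (fun i => P.expReturn T (π i)) atTop (𝓝 J)) ∧
      (Finite A → ∃ πopt : ℕ → BAPolicy Θ S ν, (∀ i, P.IsBayesOptimal T (πopt i)) ∧
        ∀ t < T, ∀ p : BAPolicy Θ S ν, ∀ᵐ x ∂(P.stateLaw p t), ∀ a,
          Tendsto (fun i => ((π i).act t x).real {a} - ((πopt i).act t x).real {a})
            atTop (𝓝 0)) ∧
      (Finite A →
        (∃ ε > 0, ∀ t < T, ∀ᵐ x ∂(P.stateLaw π₁ t), ∀ a, ε ≤ (π₁.act t x).real {a}) →
        ∃ πopt : BAPolicy Θ S ν, P.IsBayesOptimal T πopt ∧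
          ∀ t < T, ∀ p : BAPolicy Θ S ν, ∀ᵐ x ∂(P.stateLaw p t), ∀ a,
            Tendsto (fun i => ((π i).act t x).real {a}) atTop (𝓝 ((πopt.act t x).real {a}))) := by
  refine ⟨⟨_, _, rfl, BayesRL.isEMRun_softIterate hR T π₁⟩, ?_⟩
  rintro π q rfl hrun
  have hae := fun i p t ht => hrun.ae_act_eq_softIterate hR hfull i p (t := t) ht
  refine ⟨⟨_, BayesRL.isLUB_integral_optValue hR _ hfull, ?_⟩, fun _ => ?_, ?_⟩
  · refine (BayesRL.tendsto_expReturn_softIterate hR _ hfull).congr fun i => ?_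
    exact (P.expReturn_congr fun t ht => hae i (π i) t ht).symm
  · refine ⟨_, fun i => BayesRL.isBayesOptimal_greedy hR hfull
      (BayesRL.act_greedySet_ne_zero hR (BayesRL.softIterate_full hR hfull i)),
      fun t ht p => ?_⟩
    -- Countably many iterates share one exceptional null set.
    filter_upwards [ae_all_iff.2 fun i => hae i p t ht] with x hx a
    simp_rw [hx]
    exact BayesRL.tendsto_softIterate_sub_greedy hR hfull ht x a
  · rintro _ ⟨ε, hε, hlow⟩
    refine ⟨BayesRL.limitPolicy hR hfull, BayesRL.isBayesOptimal_limitPolicy hR hfull,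
      fun t ht p => ?_⟩
    filter_upwards [ae_all_iff.2 fun i => hae i p t ht,
      -- The limit is known almost everywhere under `π 0`, whose state law dominates that of `p`.
      (P.absolutelyContinuous_stateLaw hfull p ht.le).ae_le
        (BayesRL.ae_tendsto_softIterate_limitPolicy hR hfull hε hlow ht)] with x hx hlim a
    simp_rw [hx]
    exact hlim a
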